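/- **Model.** Let $n\ge 1$. In an $n\times n$ input-queued switch the queue lengths $q(t)=(q_{ij}(t))\in\mathbb{Z}_{\ge0}^{n\times n}$ evolve by $q_{ij}(t+1)=\max\{q_{ij}(t)+a_{ij}(t)-s_{ij}(t),0\}$. The arrivals $a(t)\in\mathbb{Z}_{\ge0}^{n\times n}$ are i.i.d. in $t$, independent across the pairs $(i,j)$, bounded by a constant $a_{\max}$, and independent of the past and of the schedule $s(t)$. Under MaxWeight, $s(t)$ is, given $q(t)$, a (possibly random, ties broken in any way that depends only on $q(t)$) permutation matrix that maximizes $\sum_{ij}q_{ij}(t)s_{ij}$ among all $0/1$ matrices with row and column sums at most $1$. Write $\langle x,y\rangle=\sum_{ij}x_{ij}y_{ij}$ and $\|x\|^2=\langle x,x\rangle$. **Setting.** Let $0\le n_1,n_2<n$, let $\mathcal C=\{x\in\mathbb{R}_{+}^{n\times n}:\sum_j x_{ij}\le1\ \forall i,\ \sum_i x_{ij}\le 1\ \forall j\}$, and let $\mathcal F$ be the face of $\mathcal C$ on which $\sum_jx_{ij}=1$ for $i\le n_1$ and $\sum_ix_{ij}=1$ for $j\le n_2$. Let $\nu$ be in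 the relative interior of $\mathcal F$ with $\nu_{ij}>0$ for all $i,j$, and let $k\in\mathbb{R}_+^{n\times n}$ satisfy $\sum_{ij}k_{ij}=n$. Put $\kappa_i=\sum_jk_{ij}$, $\tilde\kappa_j=\sum_ik_{ij}$, and assume $\kappa_i>0$ for $i\le n_1$ and $\tilde\kappa_j>0$ for $j\le n_2$. Let $$\nu'_{\min}=\min\Big\{\min_{i,j}\nu_{ij},\ \min_{i>n_1}\big(1-\textstyle\sum_j\nu_{ij}\big),\ \min_{j>n_2}\big(1-\sum_i\nu_{ij}\big)\Big\},\qquad \epsilon_0=\frac{\nu'_{\min}}{2\|k\|}.$$ For each $0<\epsilon\le\epsilon_0$ consider such a switch under MaxWeight whose arrivals are bounded by $a_{\max}$ (not depending on $\epsilon$), with means $\lambda^{(\epsilon)}_{ij}=\nu_{ij}-\epsilon k_{ij}$ and variances $(\sigma^{(\epsilon)}_{ij})^2$ such that $\sum_{ij}(\sigma_{ij}^{(\epsilon)})^2\le\tilde\sigma^2$ for some $\tilde\sigma^2$ not depending on $\epsilon$. Write $(\sigma^{(\epsilon)})^2$ for the matrix $\big((\sigma^{(\epsilon)}_{ij})^2\big)_{ij}$.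 Define $$\zeta_{ij}=\begin{cases}2-\frac{2n-n_1-n_2}{n^2-n_1n_2}& i\le n_1,\ j\le n_2\\ 1+\frac{n_2}{n^2-n_1n_2}& i\le n_1,\ j>n_2\\ 1+\frac{n_1}{n^2-n_1n_2}& i>n_1,\ j\le n_2\\ 0& i>n_1,\ j>n_2.\end{cases}$$ **Theorem.** For each $0<\epsilon\le\epsilon_0$ the queue length chain has a stationary probability law to which it converges in distribution from every initial law. Let $\bar q^{(\epsilon)}$ have this steady-state law; then $\mathbb{E}[\bar q^{(\epsilon)}_{ij}]<\infty$ for all $i,j$. Let $\alpha\in\mathbb{R}^{n\times n}$ (entries may be negative) satisfy $\sum_j\alpha_{ij}=n\kappa_i$ for $i\le n_1$ and $\sum_i\alpha_{ij}=n\tilde\kappa_j$ for $j\le n_2$. Then there are functions $B_1,B_2$ with $\lim_{\epsilon\downarrow0}\epsilon B_1(\epsilon)=\lim_{\epsilon\downarrow0}\epsilon B_2(\epsilon)=0$ such that for all $0<\epsilon\le\epsilon_0$ $$\frac1{2\epsilon}\langle(\sigma^{(\epsilon)})^2,\zeta\rangle-B_1(\epsilon)\ \le\ \mathbb{E}\big[\langle\bar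 q^{(\epsilon)},\alpha\rangle\big]\ \le\ \frac1{2\epsilon}\langle(\sigma^{(\epsilon)})^2,\zeta\rangle+B_2(\epsilon).$$ Consequently, if $(\sigma^{(\epsilon)})^2\to\sigma^2$ entrywise as $\epsilon\downarrow0$, then $$\lim_{\epsilon\downarrow0}\epsilon\,\mathbb{E}\big[\langle\bar q^{(\epsilon)},\alpha\rangle\big]=\tfrac12\langle\sigma^2,\zeta\rangle.$$ Moreover, $\lim_{\epsilon\downarrow0}\epsilon\,\mathbb{E}[\bar q^{(\epsilon)}_{ij}]=0$ for all $i>n_1$, $j>n_2$. -/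

import Mathlib

open MeasureTheory ProbabilityTheory Filter Topology
open scoped BoundedContinuousFunction

/-- Matrices of natural numbers indexed by (input port, output port): queue lengths, arrivals and
schedules of an `n × n` input-queued switch. They carry the product (discrete) topology and
sigma-algebra. -/
abbrev PortMatrix (n : ℕ) : Type := Fin n → Fin n → ℕ

/-- The inner product `⟨x, y⟩` of `ℝ^(n²)`. -/
def matInner {n : ℕ} (x y : Fin n → Fin n → ℝ) : ℝ := ∑ i, ∑ j, x i j * y i j

/-- The Euclidean norm of `ℝ^(n²)`. -/
noncomputable def matNorm {n : ℕ} (x : Fin n → Fin n → ℝ) : ℝ := Real.sqrt (matInner x x)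

/-- The feasible schedules: matchings between input and output ports. -/
def schedules (n : ℕ) : Set (PortMatrix n) :=
  {s | (∀ i j, s i j = 0 ∨ s i j = 1) ∧ (∀ i, ∑ j, s i j ≤ 1) ∧ (∀ j, ∑ i, s i j ≤ 1)}

/-- The maximal schedules: perfect matchings between input and output ports. -/
def maximalSchedules (n : ℕ) : Set (PortMatrix n) :=
  {s | (∀ i j, s i j = 0 ∨ s i j = 1) ∧ (∀ i, ∑ j, s i j = 1) ∧ (∀ j, ∑ i, s i j = 1)}

/-- The weight of the schedule `s` when the queue lengths are `q`. -/
def scheduleWeight {n : ℕ} (q s : PortMatrix n) : ℕ := ∑ i, ∑ j, q i j * s i j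

/-- A (possibly randomized) MaxWeight scheduling policy: when the queue lengths are `q`, the
schedule is drawn from `φ q`, and it is a maximal schedule whose weight is maximal among all
feasible schedules. Ties may be broken in any way. -/
structure IsMaxWeight {n : ℕ} (φ : Kernel (PortMatrix n) (PortMatrix n)) : Prop where
  markov : IsMarkovKernel φ
  maximal : ∀ q, ∀ᵐ s ∂(φ q), s ∈ maximalSchedules n
  maxWeight : ∀ q, ∀ᵐ s ∂(φ q), ∀ s' ∈ schedules n, scheduleWeight q s' ≤ scheduleWeight q s

/-- `A` is a law of the arrivals `a = (a i j)` of one time slot: the numbers of packets are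
independent across the pairs (input port, output port), bounded by `amax`, with mean `rate`. -/
structure IsArrivalLaw {n : ℕ} (A : Measure (PortMatrix n)) (amax : ℕ)
    (rate : Fin n → Fin n → ℝ) : Prop where
  prob : IsProbabilityMeasure A
  indep : iIndepFun (fun (p : Fin n × Fin n) (a : PortMatrix n) => a p.1 p.2) A
  bounded : ∀ᵐ a ∂A, ∀ i j, a i j ≤ amax
  mean : ∀ i j, ∫ a, (a i j : ℝ) ∂A = rate i j

/-- The matrix of variances of the arrivals of one time slot. -/
noncomputable def arrivalVariance {n : ℕ} (A : Measure (PortMatrix n)) : Fin n → Fin n → ℝ :=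
  fun i j => variance (fun a : PortMatrix n => (a i j : ℝ)) A

/-- The queue lengths after one time slot, `max (q + a - s) 0` in each coordinate (subtraction of
natural numbers truncates at `0`). -/
def queueUpdate {n : ℕ} (q s a : PortMatrix n) : PortMatrix n :=
  fun i j => q i j + a i j - s i j

/-- The transition kernel of the queue length process: from `q`, a schedule `s` is drawn from `φ q`
and, independently of it and of the past, the arrivals `a` are drawn from `A`. -/
noncomputable def switchKernel {n : ℕ} (φ : Kernel (PortMatrix n) (PortMatrix n))
    (A : Measure (PortMatrix n)) : Kernel (PortMatrix n) (PortMatrix n) :=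
  Kernel.ofFunOfCountable fun q => ((φ q).prod A).map fun p => queueUpdate q p.1 p.2

theorem switchKernel_isMarkovKernel {n : ℕ} (φ : Kernel (PortMatrix n) (PortMatrix n))
    (A : Measure (PortMatrix n)) [IsMarkovKernel φ] [IsProbabilityMeasure A] :
    IsMarkovKernel (switchKernel φ A) :=
  ⟨fun _ => Measure.isProbabilityMeasure_map (Measurable.of_discrete).aemeasurable⟩

/-- The law at time `t` of the Markov chain with transition kernel `K` and initial law `ρ`. -/
noncomputable def chainLaw {X : Type*} [MeasurableSpace X] (K : Kernel X X) (ρ : Measure X)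
    (t : ℕ) : Measure X :=
  (fun m => m.bind K)^[t] ρ

/-- `π` is the steady state law of the Markov chain with transition kernel `K`: it is a stationary
probability law, and from every initial law the chain converges to it in distribution (so `π` is
the only stationary probability law). -/
structure IsSteadyState {X : Type*} [MeasurableSpace X] [TopologicalSpace X] (K : Kernel X X)
    (π : Measure X) : Prop where
  prob : IsProbabilityMeasure π
  invariant : K.Invariant π
  tendsto : ∀ ρ : Measure X, IsProbabilityMeasure ρ → ∀ f : X →ᵇ ℝ,
    Tendsto (fun t => ∫ x, f x ∂(chainLaw K ρ t)) atTop (𝓝 (∫ x, f x ∂π))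

/-- The capacity region of the switch. -/
def capacityRegion (n : ℕ) : Set (Fin n → Fin n → ℝ) :=
  {x | (∀ i j, 0 ≤ x i j) ∧ (∀ i, ∑ j, x i j ≤ 1) ∧ (∀ j, ∑ i, x i j ≤ 1)}

/-- The face of the capacity region on which the first `n1` rows and the first `n2` columns are
saturated (ports are numbered from `0`). -/
def saturatedFace (n n1 n2 : ℕ) : Set (Fin n → Fin n → ℝ) :=
  {x | x ∈ capacityRegion n ∧ (∀ i : Fin n, (i : ℕ) < n1 → ∑ j, x i j = 1) ∧
    (∀ j : Fin n, (j : ℕ) < n2 → ∑ i, x i j = 1)}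

/-- The minimum of all entries of `ν` and of all slacks `1 - ∑ j, ν i j`, `1 - ∑ i, ν i j` of the
unsaturated rows and columns. -/
noncomputable def nuMin' {n : ℕ} (n1 n2 : ℕ) (ν : Fin n → Fin n → ℝ) : ℝ :=
  min (⨅ p : Fin n × Fin n, ν p.1 p.2)
    (min (⨅ i : {i : Fin n // n1 ≤ (i : ℕ)}, (1 - ∑ j, ν i j))
      (⨅ j : {j : Fin n // n2 ≤ (j : ℕ)}, (1 - ∑ i, ν i j)))

/-- The vector `ζ` of the heavy traffic limit. -/
noncomputable def zeta (n n1 n2 : ℕ) : Fin n → Fin n → ℝ := fun i j =>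
  if (i : ℕ) < n1 then
    if (j : ℕ) < n2 then 2 - (2 * n - n1 - n2 : ℝ) / ((n : ℝ) ^ 2 - n1 * n2)
    else 1 + (n2 : ℝ) / ((n : ℝ) ^ 2 - n1 * n2)
  else
    if (j : ℕ) < n2 then 1 + (n1 : ℝ) / ((n : ℝ) ^ 2 - n1 * n2)
    else 0

/-- The mean `E ⟨q, α⟩` of a weighted sum of queue lengths `q` with law `π`. -/
noncomputable def meanWeighted {n : ℕ} (π : Measure (PortMatrix n)) (α : Fin n → Fin n → ℝ) : ℝ :=
  ∫ q, matInner (fun i j => (q i j : ℝ)) α ∂π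

/-! Stability and heavy traffic both rest on one observation: the MaxWeight schedule maximizes a
linear form over the whole capacity region (Birkhoff–von Neumann, `inner_le_of_maxWeight`), so room
to move the rate vector inside the region becomes negative drift.

Ergodicity: for fixed `ε` the rates are interior, and the fourth power of the norm is a Lyapunov
function with drift at most a constant minus the squared norm. This yields a stationary law with
finite second moments. Loss of memory comes from a maximum principle for two independent copies of
the chain (`coupled_subharmonic_eq_zero`), since a run of slots without arrivals empties the switch.

Collapse: let `S` be the span of the indicators of saturated rows and columns, `P` the orthogonal
projection on `S`, and let the cone consist of the nonnegative elements of `S`. If `d` is `q` minus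
its nearest cone point, `d` lies in the polar cone, so a small step from `ν` along `d` stays in the
capacity region. Vectors of `S` cannot distinguish `ν` from a perfect matching. Hence the distance
to the cone has drift bounded away from zero uniformly in small `ε`, and its second moment is
bounded uniformly (`integral_infDist_satCone_sq_le`).

Balance: in steady state the mean drift of `‖P q‖²` is zero. With `q' = q + a - s + u`, `u` the
unused service, this reads `2 ε E⟨P k, q⟩ = E‖P (a - s)‖² + E[2⟨P q', u⟩ - ‖P u‖²]`. The first term
on the right is `⟨σ², ζ⟩ / n + O(ε²)`, because `P s = P ν` and the diagonal of `P` is `ζ / n`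
(`satProj_single_apply`). Where `u` is nonzero `q'` vanishes, so `P q'` there equals `-(q' - P q')`,
which is bounded in mean square by the collapse. The mean of the relevant unused service is `O(ε)`,
and a weighted arithmetic-geometric inequality makes the last term `O(√ε)`.

Finally `P α = n P k`, so `⟨q, α⟩` is `n ⟨P k, q⟩` plus a term with bounded mean. On pairs of
unsaturated ports `P q` vanishes, which bounds those mean queue lengths. -/

section MarkovChain

/-! ### Countable Markov chains: Foster–Lyapunov drift and ergodicity -/

set_option linter.unusedSectionVars false

variable {X : Type*} [MeasurableSpace X] [DiscreteMeasurableSpace X]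

/-- A measure carried by a finite set. -/
def FinitelySupported (μ : Measure X) : Prop := ∃ F : Set X, F.Finite ∧ μ Fᶜ = 0

/-- Bounded arrivals and 0/1 schedules make each one-step law finitely supported, so no one-step
expectation needs a separate integrability argument. -/
theorem FinitelySupported.integrable {μ : Measure X} [IsFiniteMeasure μ]
    (h : FinitelySupported μ) (f : X → ℝ) : Integrable f μ := by
  obtain ⟨F, hF, h0⟩ := h
  have h1 : IntegrableOn f F μ := IntegrableOn.of_finite hF
  have h2 : μ.restrict F = μ := Measure.restrict_eq_self_of_ae_mem (by
    rw [ae_iff]; exact h0)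
  rwa [IntegrableOn, h2] at h1

theorem FinitelySupported.dirac (x : X) : FinitelySupported (Measure.dirac x) :=
  ⟨{x}, Set.finite_singleton x, by simp⟩

variable {K : Kernel X X} [IsMarkovKernel K]

theorem FinitelySupported.bind {μ : Measure X} (h : FinitelySupported μ)
    (hK : ∀ x, FinitelySupported (K x)) : FinitelySupported (μ.bind K) := by
  obtain ⟨F, hF, h0⟩ := h
  choose G hG hG0 using hK
  refine ⟨⋃ x ∈ F, G x, hF.biUnion fun x _ => hG x, ?_⟩
  rw [Measure.bind_apply (MeasurableSet.of_discrete) K.measurable.aemeasurable,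
    lintegral_eq_zero_iff (Measurable.of_discrete)]
  have : ∀ᵐ x ∂μ, x ∈ F := by rw [ae_iff]; exact h0
  filter_upwards [this] with x hx
  refine measure_mono_null ?_ (hG0 x)
  intro y hy hy'
  exact hy (Set.mem_biUnion hx hy')

theorem integral_bind_of_integrable {μ : Measure X} {f : X → ℝ}
    (hf : Integrable f (μ.bind K)) :
    ∫ x, f x ∂(μ.bind K) = ∫ x, ∫ y, f y ∂(K x) ∂μ := by
  rw [Measure.comp_eq_comp_const_apply] at hf ⊢
  rw [Kernel.integral_comp hf]
  simp

theorem chainLaw_succ (ρ : Measure X) (t : ℕ) :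
    chainLaw K ρ (t + 1) = (chainLaw K ρ t).bind K := by
  simp [chainLaw, Function.iterate_succ_apply']

theorem isProbabilityMeasure_chainLaw (ρ : Measure X) [IsProbabilityMeasure ρ] (t : ℕ) :
    IsProbabilityMeasure (chainLaw K ρ t) := by
  induction t with
  | zero => simpa [chainLaw]
  | succ t ih => rw [chainLaw_succ]; infer_instance

theorem finitelySupported_chainLaw (hK : ∀ x, FinitelySupported (K x)) (x : X) (t : ℕ) :
    FinitelySupported (chainLaw K (Measure.dirac x) t) := by
  induction t with
  | zero => simpa [chainLaw] using FinitelySupported.dirac x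
  | succ t ih => rw [chainLaw_succ]; exact ih.bind hK

theorem chainLaw_of_invariant {π : Measure X} (hπ : K.Invariant π) (t : ℕ) :
    chainLaw K π t = π := by
  induction t with
  | zero => simp [chainLaw]
  | succ t ih => rw [chainLaw_succ, ih, hπ.def]

/-- The Markov operator of a kernel, acting on functions. -/
noncomputable def markovOp (K : Kernel X X) (f : X → ℝ) : X → ℝ := fun x => ∫ y, f y ∂(K x)

theorem abs_integral_le_of_abs_le {μ : Measure X} [IsProbabilityMeasure μ] {f : X → ℝ} {B : ℝ}
    (hf : ∀ x, |f x| ≤ B) : |∫ x, f x ∂μ| ≤ B := by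
  have h := norm_integral_le_of_norm_le_const (μ := μ) (f := f) (C := B)
    (Eventually.of_forall hf)
  simpa using h

theorem integrable_of_abs_le {μ : Measure X} [IsFiniteMeasure μ] {f : X → ℝ} {B : ℝ}
    (hf : ∀ x, |f x| ≤ B) : Integrable f μ :=
  Integrable.of_bound (Measurable.of_discrete).aestronglyMeasurable B
    (Eventually.of_forall hf)

theorem abs_iterate_markovOp_le {f : X → ℝ} {B : ℝ} (hf : ∀ x, |f x| ≤ B) (t : ℕ) (x : X) :
    |(markovOp K)^[t] f x| ≤ B := by
  induction t generalizing x with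
  | zero => exact hf x
  | succ t ih =>
    rw [Function.iterate_succ_apply']
    exact abs_integral_le_of_abs_le ih

theorem integral_chainLaw {f : X → ℝ} {B : ℝ} (hf : ∀ x, |f x| ≤ B)
    (ρ : Measure X) [IsProbabilityMeasure ρ] (t : ℕ) :
    ∫ x, f x ∂(chainLaw K ρ t) = ∫ x, (markovOp K)^[t] f x ∂ρ := by
  induction t generalizing f with
  | zero => simp [chainLaw]
  | succ t ih =>
    have := isProbabilityMeasure_chainLaw (K := K) ρ t
    rw [chainLaw_succ, integral_bind_of_integrable (integrable_of_abs_le hf),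
      Function.iterate_succ_apply]
    exact ih (f := markovOp K f) fun x => abs_integral_le_of_abs_le hf

/-- The drift inequality telescopes along the chain. A point mass as initial law keeps every
marginal finitely supported, so `V` is integrable at each time. -/
theorem sum_integral_chainLaw_le (hK : ∀ x, FinitelySupported (K x)) {V f : X → ℝ} {C : ℝ}
    (hV : ∀ x, 0 ≤ V x) (hd : ∀ x, ∫ y, V y ∂(K x) ≤ V x - f x + C) (x : X) (T : ℕ) :
    ∑ t ∈ Finset.range T, ∫ y, f y ∂(chainLaw K (Measure.dirac x) t) ≤ V x + T * C := by
  have key : ∀ T : ℕ, ∑ t ∈ Finset.range T, ∫ y, f y ∂(chainLaw K (Measure.dirac x) t)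
      + ∫ y, V y ∂(chainLaw K (Measure.dirac x) T) ≤ V x + T * C := by
    intro T
    induction T with
    | zero => simp [chainLaw]
    | succ T ih =>
      have hp := isProbabilityMeasure_chainLaw (K := K) (Measure.dirac x) T
      have hp' := isProbabilityMeasure_chainLaw (K := K) (Measure.dirac x) (T + 1)
      have hs := finitelySupported_chainLaw hK x T
      have hs' := finitelySupported_chainLaw hK x (T + 1)
      rw [Finset.sum_range_succ]
      have h1 : ∫ y, V y ∂(chainLaw K (Measure.dirac x) (T + 1)) ≤
          ∫ y, (V y - f y + C) ∂(chainLaw K (Measure.dirac x) T) := by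
        have hi := hs'.integrable V
        rw [chainLaw_succ] at hi ⊢
        rw [integral_bind_of_integrable hi]
        exact integral_mono (hs.integrable _) (hs.integrable _) hd
      rw [integral_add (hs.integrable _) (integrable_const _),
        integral_sub (hs.integrable _) (hs.integrable _)] at h1
      simp only [integral_const, probReal_univ, one_smul] at h1
      push_cast
      linarith
  have := key T
  have h2 : 0 ≤ ∫ y, V y ∂(chainLaw K (Measure.dirac x) T) := integral_nonneg hV
  linarith

/-- A bounded function which is subharmonic for two independent copies of a chain with a
Foster-Lyapunov function and an accessible state vanishes if it vanishes there. -/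
theorem coupled_subharmonic_eq_zero (hK : ∀ x, FinitelySupported (K x)) {V w : X → ℝ} {b : ℝ}
    (hV : ∀ x, 0 ≤ V x) (hw : ∀ x, 0 ≤ w x) (hwfin : ∀ M, {x | w x ≤ M}.Finite)
    (hd : ∀ x, ∫ y, V y ∂(K x) ≤ V x - w x + b)
    {g : X → X} {x₀ : X} (hg : ∀ x, K x {g x} ≠ 0) (hreach : ∀ x, ∃ m, ∀ t ≥ m, g^[t] x = x₀)
    {h : X → X → ℝ} {B : ℝ} (h0 : ∀ x y, 0 ≤ h x y) (hB : ∀ x y, h x y ≤ B)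
    (hdiag : h x₀ x₀ = 0) (hsub : ∀ x y, h x y ≤ ∫ x', ∫ y', h x' y' ∂(K y) ∂(K x)) (x y : X) :
    h x y = 0 := by
  have hint : ∀ (x : X) (f : X → ℝ), Integrable f (K x) := fun x f => (hK x).integrable f
  have hwV : ∀ x, w x ≤ V x + b := fun x => by
    have := hd x
    have h2 : 0 ≤ ∫ y, V y ∂(K x) := integral_nonneg hV
    linarith
  have hfin : ∀ M, {p : X × X | w p.1 + w p.2 ≤ M}.Finite := fun M =>
    ((hwfin M).prod (hwfin M)).subset fun p hp => by
      have h1 := hw p.1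
      have h2 := hw p.2
      simp only [Set.mem_ofPred_eq, Set.mem_prod] at hp ⊢
      constructor <;> linarith
  -- Outside this finite set of pairs, `V x + V y` has drift below `-1`. The pair `(x₀, x₀)` is
  -- inserted only to make the set nonempty.
  obtain ⟨p, -, hp⟩ := Set.exists_max_image (insert (x₀, x₀) {p : X × X | w p.1 + w p.2 ≤ 2 * b + 1})
    (fun p => h p.1 p.2) ((hfin _).insert _) ⟨_, Set.mem_insert _ _⟩
  -- Maximum principle: otherwise the penalized function `h - s (V + V)` attains its maximum at some
  -- `r` outside the finite set. There `h` does not decrease in mean and `V + V` strictly decreases,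
  -- so the mean after one step would exceed the maximum.
  have hmax : ∀ x y, h x y ≤ h p.1 p.2 := by
    by_contra hcon
    push Not at hcon
    obtain ⟨x, y, hxy⟩ := hcon
    -- The penalty `s` is small enough to cost at most half of the excess of `h x y`; the `+ 1`
    -- keeps the denominator positive.
    obtain ⟨s, hs, hsW⟩ : ∃ s > 0, h p.1 p.2 < h x y - s * (V x + V y) := by
      have hW : 0 < V x + V y + 1 := by linarith [hV x, hV y]
      refine ⟨(h x y - h p.1 p.2) / (2 * (V x + V y + 1)), by
        apply div_pos <;> linarith, ?_⟩
      have : (h x y - h p.1 p.2) / (2 * (V x + V y + 1)) * (V x + V y)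
          ≤ (h x y - h p.1 p.2) / 2 := by
        rw [div_mul_eq_mul_div, div_le_div_iff₀ (by linarith) (by norm_num)]
        nlinarith
      linarith
    have hGfin : {r : X × X | h x y - s * (V x + V y) ≤ h r.1 r.2 - s * (V r.1 + V r.2)}.Finite := by
      refine (hfin ((B - h x y) / s + (V x + V y) + 2 * b)).subset fun r hr => ?_
      simp only [Set.mem_ofPred_eq] at hr ⊢
      have h1 : V r.1 + V r.2 ≤ (B - h x y) / s + (V x + V y) := by
        rw [← sub_le_iff_le_add, le_div_iff₀ hs]
        nlinarith [hB r.1 r.2]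
      linarith [hwV r.1, hwV r.2]
    obtain ⟨r, hr, hrmax⟩ := Set.exists_max_image _ (fun r : X × X => h r.1 r.2 - s * (V r.1 + V r.2))
      hGfin ⟨(x, y), le_refl (h x y - s * (V x + V y))⟩
    have hrm : ∀ x' y', h x' y' - s * (V x' + V y') ≤ h r.1 r.2 - s * (V r.1 + V r.2) := by
      intro x' y'
      by_cases hc : h x y - s * (V x + V y) ≤ h x' y' - s * (V x' + V y')
      · exact hrmax (x', y') hc
      · simp only [Set.mem_ofPred_eq] at hr
        linarith
    have hrC : 2 * b + 1 < w r.1 + w r.2 := by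
      by_contra hc
      have h1 := hp r (Set.mem_insert_of_mem _ (not_lt.mp hc))
      simp only [Set.mem_ofPred_eq] at hr h1
      have h2 : 0 ≤ s * (V r.1 + V r.2) := mul_nonneg hs.le (by linarith [hV r.1, hV r.2])
      linarith
    have e1 : ∫ x', ∫ y', (h x' y' - s * (V x' + V y')) ∂(K r.2) ∂(K r.1)
        = (∫ x', ∫ y', h x' y' ∂(K r.2) ∂(K r.1))
          - s * ((∫ x', V x' ∂(K r.1)) + ∫ y', V y' ∂(K r.2)) := by
      have : ∀ x', ∫ y', (h x' y' - s * (V x' + V y')) ∂(K r.2)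
          = (∫ y', h x' y' ∂(K r.2)) - s * (V x' + ∫ y', V y' ∂(K r.2)) := by
        intro x'
        rw [integral_sub (hint _ _) (hint _ _), integral_const_mul,
          integral_add (hint _ _) (hint _ _)]
        simp
      simp_rw [this]
      rw [integral_sub (hint _ _) (hint _ _), integral_const_mul,
          integral_add (hint _ _) (hint _ _)]
      simp
    have e2 : ∫ x', ∫ y', (h x' y' - s * (V x' + V y')) ∂(K r.2) ∂(K r.1)
        ≤ h r.1 r.2 - s * (V r.1 + V r.2) := by
      calc _ ≤ ∫ x', ∫ y', (h r.1 r.2 - s * (V r.1 + V r.2)) ∂(K r.2) ∂(K r.1) :=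
            integral_mono (hint _ _) (hint _ _) fun x' =>
              integral_mono (hint _ _) (hint _ _) fun y' => hrm x' y'
        _ = _ := by simp
    have e3 := hsub r.1 r.2
    have e4 := mul_le_mul_of_nonneg_left (add_le_add (hd r.1) (hd r.2)) hs.le
    have e5 := mul_lt_mul_of_pos_left hrC hs
    nlinarith
  -- At a maximum point, the maximum is at most an average of values that do not exceed it, so it is
  -- attained at every pair of positive mass, in particular at `(g x, g y)`.
  have hstep : ∀ x y, h x y = h p.1 p.2 → h (g x) (g y) = h p.1 p.2 := by
    intro x y hxy
    have e0 : ∫ x', ∫ y', (h p.1 p.2 - h x' y') ∂(K y) ∂(K x) = 0 := by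
      refine le_antisymm ?_ (integral_nonneg fun x' => integral_nonneg fun y' =>
        sub_nonneg.mpr (hmax x' y'))
      have : ∀ x', ∫ y', (h p.1 p.2 - h x' y') ∂(K y) = h p.1 p.2 - ∫ y', h x' y' ∂(K y) := by
        intro x'
        rw [integral_sub (hint _ _) (hint _ _)]
        simp
      simp_rw [this]
      rw [integral_sub (hint _ _) (hint _ _)]
      simp only [integral_const, probReal_univ, one_smul]
      linarith [hsub x y]
    rw [integral_eq_zero_iff_of_nonneg (fun x' => integral_nonneg fun y' =>
        sub_nonneg.mpr (hmax x' y')) (hint _ _)] at e0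
    have e1 : ∫ y', (h p.1 p.2 - h (g x) y') ∂(K y) = 0 := by
      by_contra hc
      exact hg x (measure_mono_null (by simpa using hc) (ae_iff.mp e0))
    rw [integral_eq_zero_iff_of_nonneg (fun y' => sub_nonneg.mpr (hmax _ y')) (hint _ _)] at e1
    by_contra hc
    refine hg y (measure_mono_null ?_ (ae_iff.mp e1))
    simp only [Set.singleton_subset_iff, Set.mem_ofPred_eq, Pi.zero_apply]
    exact fun h' => hc (by linarith)
  have hiter : ∀ t, h (g^[t] p.1) (g^[t] p.2) = h p.1 p.2 := by
    intro t
    induction t with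
    | zero => rfl
    | succ t ih => rw [Function.iterate_succ_apply', Function.iterate_succ_apply']; exact hstep _ _ ih
  obtain ⟨m₁, hm₁⟩ := hreach p.1
  obtain ⟨m₂, hm₂⟩ := hreach p.2
  -- Both copies must sit at `x₀` simultaneously. This is where `hreach` is needed for all large
  -- times; it plays the role of aperiodicity.
  have h1 := hiter (max m₁ m₂)
  rw [hm₁ _ (le_max_left _ _), hm₂ _ (le_max_right _ _), hdiag] at h1
  exact le_antisymm (h1 ▸ hmax x y) (h0 x y)

/-- Loss of memory of the initial state. -/
theorem tendsto_iterate_markovOp_sub (hK : ∀ x, FinitelySupported (K x)) {V w : X → ℝ} {b : ℝ}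
    (hV : ∀ x, 0 ≤ V x) (hw : ∀ x, 0 ≤ w x) (hwfin : ∀ M, {x | w x ≤ M}.Finite)
    (hd : ∀ x, ∫ y, V y ∂(K x) ≤ V x - w x + b)
    {g : X → X} {x₀ : X} (hg : ∀ x, K x {g x} ≠ 0) (hreach : ∀ x, ∃ m, ∀ t ≥ m, g^[t] x = x₀)
    {f : X → ℝ} {B : ℝ} (hf : ∀ x, |f x| ≤ B) (x y : X) :
    Tendsto (fun t => (markovOp K)^[t] f x - (markovOp K)^[t] f y) atTop (𝓝 0) := by
  have hint : ∀ (x : X) (f : X → ℝ), Integrable f (K x) := fun x f => (hK x).integrable f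
  set D : ℕ → X → X → ℝ := fun t x y => |(markovOp K)^[t] f x - (markovOp K)^[t] f y| with hD
  have hD0 : ∀ t x y, 0 ≤ D t x y := fun t x y => abs_nonneg _
  have hDB : ∀ t x y, D t x y ≤ 2 * B := fun t x y => by
    have h1 := abs_iterate_markovOp_le (K := K) hf t x
    have h2 := abs_iterate_markovOp_le (K := K) hf t y
    exact (abs_sub _ _).trans (by linarith)
  have hDsub : ∀ t x y, D (t + 1) x y ≤ ∫ x', ∫ y', D t x' y' ∂(K y) ∂(K x) := by
    intro t x y
    have e : (markovOp K)^[t + 1] f x - (markovOp K)^[t + 1] f y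
        = ∫ x', ∫ y', ((markovOp K)^[t] f x' - (markovOp K)^[t] f y') ∂(K y) ∂(K x) := by
      have : ∀ x', ∫ y', ((markovOp K)^[t] f x' - (markovOp K)^[t] f y') ∂(K y)
          = (markovOp K)^[t] f x' - (markovOp K)^[t + 1] f y := by
        intro x'
        rw [integral_sub (hint _ _) (hint _ _), Function.iterate_succ_apply']
        simp [markovOp]
      simp_rw [this]
      rw [integral_sub (hint _ _) (hint _ _), Function.iterate_succ_apply' _ _ f]
      simp [markovOp]
    simp only [hD]
    rw [e]
    exact (abs_integral_le_integral_abs).trans (integral_mono (hint _ _) (hint _ _) fun x' =>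
      abs_integral_le_integral_abs)
  -- `D t` need not be monotone in `t`. Its supremum over future times is, so it has a pointwise
  -- limit, and dominated convergence passes the subharmonic inequality to that limit.
  set u : ℕ → X → X → ℝ := fun t x y => ⨆ s, D (t + s) x y with hu
  have hbdd : ∀ t x y, BddAbove (Set.range fun s => D (t + s) x y) := fun t x y =>
    ⟨2 * B, by rintro _ ⟨s, rfl⟩; exact hDB _ _ _⟩
  have hDu : ∀ t x y, D t x y ≤ u t x y := fun t x y => le_ciSup (hbdd t x y) 0
  have hu0 : ∀ t x y, 0 ≤ u t x y := fun t x y => (hD0 t x y).trans (hDu t x y)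
  have huB : ∀ t x y, u t x y ≤ 2 * B := fun t x y => ciSup_le fun s => hDB _ _ _
  have hanti : ∀ x y, Antitone fun t => u t x y := fun x y => antitone_nat_of_succ_le fun t =>
    ciSup_le fun s => by
      have := le_ciSup (hbdd t x y) (1 + s)
      simpa [add_assoc] using this
  have hbelow : ∀ x y, BddBelow (Set.range fun t => u t x y) := fun x y =>
    ⟨0, by rintro _ ⟨s, rfl⟩; exact hu0 _ _ _⟩
  have hlim : ∀ x y, Tendsto (fun t => u t x y) atTop (𝓝 (⨅ t, u t x y)) := fun x y =>
    tendsto_atTop_ciInf (hanti x y) (hbelow x y)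
  have husub : ∀ t x y, u (t + 1) x y ≤ ∫ x', ∫ y', u t x' y' ∂(K y) ∂(K x) := by
    intro t x y
    refine ciSup_le fun s => ?_
    have h1 := hDsub (t + s) x y
    rw [show t + s + 1 = t + 1 + s by ring] at h1
    exact h1.trans (integral_mono (hint _ _) (hint _ _) fun x' =>
      integral_mono (hint _ _) (hint _ _) fun y' => le_ciSup (hbdd t x' y') s)
  have hzero : ∀ x y, (⨅ t, u t x y) = 0 := by
    refine coupled_subharmonic_eq_zero hK hV hw hwfin hd hg hreach (B := 2 * B)
      (fun x y => le_ciInf fun t => hu0 t x y)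
      (fun x y => (ciInf_le (hbelow x y) 0).trans (huB 0 x y)) ?_ ?_
    · simp [hu, hD]
    · intro x y
      have hin : ∀ x', Tendsto (fun t => ∫ y', u t x' y' ∂(K y)) atTop
          (𝓝 (∫ y', (⨅ t, u t x' y') ∂(K y))) := fun x' =>
        tendsto_integral_of_dominated_convergence (fun _ => 2 * B)
          (fun t => (hint _ _).aestronglyMeasurable) (hint _ _)
          (fun t => Eventually.of_forall fun y' => by
            rw [Real.norm_eq_abs, abs_of_nonneg (hu0 _ _ _)]; exact huB _ _ _)
          (Eventually.of_forall fun y' => hlim x' y')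
      have hout : Tendsto (fun t => ∫ x', ∫ y', u t x' y' ∂(K y) ∂(K x)) atTop
          (𝓝 (∫ x', ∫ y', (⨅ t, u t x' y') ∂(K y) ∂(K x))) :=
        tendsto_integral_of_dominated_convergence (fun _ => 2 * B)
          (fun t => (hint _ _).aestronglyMeasurable) (hint _ _)
          (fun t => Eventually.of_forall fun x' => by
            refine abs_integral_le_of_abs_le fun y' => ?_
            rw [abs_of_nonneg (hu0 _ _ _)]; exact huB _ _ _)
          (Eventually.of_forall fun x' => hin x')
      exact le_of_tendsto_of_tendsto' ((hlim x y).comp (tendsto_add_atTop_nat 1)) hout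
        fun t => husub t x y
  rw [tendsto_zero_iff_abs_tendsto_zero]
  refine squeeze_zero (fun t => abs_nonneg _) (fun t => hDu t x y) ?_
  have := hlim x y
  rwa [hzero x y] at this

/-- Existence of a stationary probability law under a Foster-Lyapunov drift condition. -/
theorem exists_invariant_of_drift [TopologicalSpace X] [DiscreteTopology X] [Countable X]
    (hK : ∀ x, FinitelySupported (K x)) {V w : X → ℝ} {b : ℝ}
    (hV : ∀ x, 0 ≤ V x) (hw : ∀ x, 0 ≤ w x) (hwfin : ∀ M, {x | w x ≤ M}.Finite)
    (hd : ∀ x, ∫ y, V y ∂(K x) ≤ V x - w x + b) (x₀ : X) :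
    ∃ π : Measure X, IsProbabilityMeasure π ∧ K.Invariant π := by
  have hprob := fun t => isProbabilityMeasure_chainLaw (K := K) (Measure.dirac x₀) t
  have hsupp := fun t => finitelySupported_chainLaw hK x₀ t
  set ρ : ℕ → Measure X := fun t => chainLaw K (Measure.dirac x₀) t with hρ
  have hne : ∀ T : ℕ, ((T : ENNReal) + 1) ≠ 0 := fun T => by simp
  have hnt : ∀ T : ℕ, ((T : ENNReal) + 1) ≠ ⊤ := fun T => by simp
  -- Krylov–Bogoliubov: a limit point of the Cesàro averages of the laws is invariant. Averaging `T
  -- + 1` laws avoids an empty average.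
  set c : ℕ → Measure X := fun T => ((T : ENNReal) + 1)⁻¹ • ∑ t ∈ Finset.range (T + 1), ρ t with hc
  have hcp : ∀ T, IsProbabilityMeasure (c T) := fun T => ⟨by
    simp only [hc, Measure.smul_apply, Measure.finsetSum_apply, measure_univ, smul_eq_mul,
      Finset.sum_const, Finset.card_range, nsmul_eq_mul, mul_one, Nat.cast_add, Nat.cast_one]
    exact ENNReal.inv_mul_cancel (hne T) (hnt T)⟩
  have hcint : ∀ T (f : X → ℝ), ∫ x, f x ∂(c T)
      = ((T : ℝ) + 1)⁻¹ * ∑ t ∈ Finset.range (T + 1), ∫ x, f x ∂(ρ t) := by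
    intro T f
    simp only [hc]
    rw [integral_smul_measure, integral_finsetSum_measure fun t _ => (hsupp t).integrable f]
    simp [ENNReal.toReal_add, hρ]
  have hcI : ∀ T (f : X → ℝ), Integrable f (c T) := by
    intro T f
    refine Integrable.smul_measure ?_ (by simp)
    exact integrable_finsetSum_measure.mpr fun t _ => (hsupp t).integrable f
  have hcw : ∀ T, ∫ x, w x ∂(c T) ≤ V x₀ + |b| := by
    intro T
    rw [hcint]
    have h1 := sum_integral_chainLaw_le hK hV hd x₀ (T + 1)
    have hT : (0 : ℝ) < (T : ℝ) + 1 := by positivity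
    rw [inv_mul_le_iff₀ hT]
    push_cast at h1
    have h2 : 0 ≤ (T : ℝ) * V x₀ := mul_nonneg (Nat.cast_nonneg _) (hV x₀)
    have h3 : ((T : ℝ) + 1) * b ≤ ((T : ℝ) + 1) * |b| :=
      mul_le_mul_of_nonneg_left (le_abs_self b) hT.le
    simp only [hρ]
    linarith
  set μ : ℕ → ProbabilityMeasure X := fun T => ⟨c T, hcp T⟩ with hμ
  -- Markov's inequality for `w`, whose sublevel sets are finite and hence compact, against the
  -- uniform bound `hcw`.
  have htight : IsTightMeasureSet {((m : ProbabilityMeasure X) : Measure X) | m ∈ Set.range μ} := by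
    rw [isTightMeasureSet_iff_exists_isCompact_measure_compl_le]
    intro δ hδ
    rcases eq_or_ne δ ⊤ with rfl | hδt
    · exact ⟨∅, isCompact_empty, fun _ _ => le_top⟩
    have hδ' : 0 < δ.toReal := ENNReal.toReal_pos hδ.ne' hδt
    set M := (V x₀ + |b|) / δ.toReal + 1 with hM
    have hM0 : 0 < M := by
      have := hV x₀
      positivity
    refine ⟨{x | w x ≤ M}, (hwfin M).isCompact, ?_⟩
    rintro _ ⟨_, ⟨T, rfl⟩, rfl⟩
    have hTp := hcp T
    have h1 := mul_meas_ge_le_integral_of_nonneg (μ := c T) (f := w) (Eventually.of_forall hw)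
      (hcI T w) M
    have h2 : (c T).real {x | M ≤ w x} ≤ δ.toReal := by
      have h3 := h1.trans (hcw T)
      have h4 : V x₀ + |b| ≤ M * δ.toReal := by
        rw [hM, add_mul, div_mul_cancel₀ _ hδ'.ne']
        linarith
      exact le_of_mul_le_mul_left (h3.trans h4) hM0
    have h5 : (c T) {x | M ≤ w x} ≤ δ := by
      rw [← ENNReal.ofReal_toReal hδt, ← ENNReal.ofReal_toReal (measure_ne_top (c T) _)]
      exact ENNReal.ofReal_le_ofReal h2
    refine (measure_mono fun x hx => ?_).trans h5
    simp only [Set.mem_compl_iff, Set.mem_ofPred_eq, not_le] at hx ⊢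
    exact hx.le
  have hcomp := isCompact_closure_of_isTightMeasureSet htight
  -- Limits along a nonprincipal ultrafilter take the place of a convergent subsequence.
  obtain ⟨π, -, hπ⟩ := hcomp.ultrafilter_le_nhds ((hyperfilter ℕ).map μ) (by
    rw [le_principal_iff, Ultrafilter.mem_coe, Ultrafilter.mem_map]
    exact Filter.mem_of_superset Filter.univ_mem fun T _ => subset_closure ⟨T, rfl⟩)
  have hlim : ∀ f : X →ᵇ ℝ, Tendsto (fun T => ∫ x, f x ∂(c T)) (hyperfilter ℕ : Filter ℕ)
      (𝓝 (∫ x, f x ∂(π : Measure X))) :=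
    (ProbabilityMeasure.tendsto_iff_forall_integral_tendsto (μs := μ)).mp hπ
  refine ⟨π, π.2, ?_⟩
  refine ext_of_forall_integral_eq_of_IsFiniteMeasure fun f => ?_
  have hfB : ∀ x, |f x| ≤ ‖f‖ := fun x => f.norm_coe_le_norm x
  rw [integral_bind_of_integrable (integrable_of_abs_le hfB)]
  let Pf : X →ᵇ ℝ := BoundedContinuousFunction.ofNormedAddCommGroup (markovOp K f)
    continuous_of_discreteTopology ‖f‖ fun x => abs_integral_le_of_abs_le hfB
  -- Applying the kernel shifts time by one, so the difference of the two averages telescopes to its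
  -- end terms divided by `T + 1`.
  have hdiff : ∀ T, ∫ x, Pf x ∂(c T) - ∫ x, f x ∂(c T)
      = ((T : ℝ) + 1)⁻¹ * (∫ x, f x ∂(ρ (T + 1)) - ∫ x, f x ∂(ρ 0)) := by
    intro T
    rw [hcint, hcint, ← mul_sub, ← Finset.sum_sub_distrib]
    congr 1
    rw [← Finset.sum_range_sub (fun t => ∫ x, f x ∂(ρ t))]
    refine Finset.sum_congr rfl fun t _ => ?_
    have e : ∫ x, f x ∂(ρ (t + 1)) = ∫ x, Pf x ∂(ρ t) := by
      have := hprob (t + 1)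
      have hi : Integrable f (ρ (t + 1)) := integrable_of_abs_le hfB
      simp only [hρ] at hi ⊢
      rw [chainLaw_succ] at hi ⊢
      exact integral_bind_of_integrable hi
    rw [e]
  have hdiff0 : Tendsto (fun T => ∫ x, Pf x ∂(c T) - ∫ x, f x ∂(c T)) atTop (𝓝 0) := by
    simp_rw [hdiff]
    have h1 : Tendsto (fun T : ℕ => ((T : ℝ) + 1)⁻¹ * (2 * ‖f‖)) atTop (𝓝 0) := by
      have := (tendsto_one_div_add_atTop_nhds_zero_nat (𝕜 := ℝ)).mul_const (2 * ‖f‖)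
      simpa using this
    refine squeeze_zero_norm (fun T => ?_) h1
    have hT : (0 : ℝ) < (T : ℝ) + 1 := by positivity
    rw [norm_mul, Real.norm_of_nonneg (inv_nonneg.mpr hT.le)]
    refine mul_le_mul_of_nonneg_left ?_ (inv_nonneg.mpr hT.le)
    have := hprob (T + 1)
    have := hprob 0
    have h2 := abs_integral_le_of_abs_le (μ := ρ (T + 1)) hfB
    have h3 := abs_integral_le_of_abs_le (μ := ρ 0) hfB
    exact (abs_sub _ _).trans (by linarith)
  have h1 := (hlim Pf).sub (hlim f)
  have h2 := tendsto_nhds_unique h1 (hdiff0.mono_left Nat.hyperfilter_le_atTop)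
  exact sub_eq_zero.mp h2

/-- A chain with a Foster-Lyapunov function and an accessible aperiodic state is ergodic. -/
theorem exists_isSteadyState_of_drift [TopologicalSpace X] [DiscreteTopology X] [Countable X]
    (hK : ∀ x, FinitelySupported (K x)) {V w : X → ℝ} {b : ℝ}
    (hV : ∀ x, 0 ≤ V x) (hw : ∀ x, 0 ≤ w x) (hwfin : ∀ M, {x | w x ≤ M}.Finite)
    (hd : ∀ x, ∫ y, V y ∂(K x) ≤ V x - w x + b)
    {g : X → X} {x₀ : X} (hg : ∀ x, K x {g x} ≠ 0)
    (hreach : ∀ x, ∃ m, ∀ t ≥ m, g^[t] x = x₀) :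
    ∃ π : Measure X, IsSteadyState K π := by
  obtain ⟨π, hπ, hinv⟩ := exists_invariant_of_drift hK hV hw hwfin hd x₀
  refine ⟨π, hπ, hinv, fun ρ hρ f => ?_⟩
  have hfB : ∀ x, |f x| ≤ ‖f‖ := fun x => f.norm_coe_le_norm x
  -- Both `ρ` and `π` are compared with the chain started at `x₀`, and the common term `(markovOp
  -- K)^[t] f x₀` cancels. Invariance makes the mean under the chain from `π` constant.
  have key : ∀ ρ : Measure X, IsProbabilityMeasure ρ →
      Tendsto (fun t => ∫ x, ((markovOp K)^[t] f x - (markovOp K)^[t] f x₀) ∂ρ) atTop (𝓝 0) := by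
    intro ρ hρ
    have h1 := tendsto_integral_of_dominated_convergence (μ := ρ)
      (F := fun t x => (markovOp K)^[t] f x - (markovOp K)^[t] f x₀) (f := fun _ => 0)
      (fun _ => 2 * ‖f‖) (fun t => (Measurable.of_discrete).aestronglyMeasurable)
      (integrable_const _)
      (fun t => Eventually.of_forall fun x => by
        have h1 := abs_iterate_markovOp_le (K := K) hfB t x
        have h2 := abs_iterate_markovOp_le (K := K) hfB t x₀
        exact (abs_sub _ _).trans (by linarith))
      (Eventually.of_forall fun x =>
        tendsto_iterate_markovOp_sub hK hV hw hwfin hd hg hreach hfB x x₀)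
    simpa using h1
  have e : ∀ (ρ : Measure X), IsProbabilityMeasure ρ → ∀ t,
      ∫ x, f x ∂(chainLaw K ρ t) = ∫ x, ((markovOp K)^[t] f x - (markovOp K)^[t] f x₀) ∂ρ
        + (markovOp K)^[t] f x₀ := by
    intro ρ hρ t
    rw [integral_chainLaw hfB, integral_sub
      (integrable_of_abs_le (abs_iterate_markovOp_le hfB t)) (integrable_const _)]
    simp
  have h1 := ((key ρ hρ).sub (key π hπ)).add_const (∫ x, f x ∂π)
  simp only [sub_zero, zero_add] at h1
  refine h1.congr fun t => ?_
  have h2 := e ρ hρ t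
  have h3 := e π hπ t
  rw [chainLaw_of_invariant hinv] at h3
  linarith

/-- The moment bound given by a Foster-Lyapunov function in steady state. -/
theorem IsSteadyState.integrable_of_drift [TopologicalSpace X] [DiscreteTopology X] {π : Measure X}
    (hπ : IsSteadyState K π) (hK : ∀ x, FinitelySupported (K x)) {V f : X → ℝ} {C : ℝ}
    (hV : ∀ x, 0 ≤ V x) (hf : ∀ x, 0 ≤ f x) (hd : ∀ x, ∫ y, V y ∂(K x) ≤ V x - f x + C)
    (x₀ : X) : Integrable f π ∧ ∫ x, f x ∂π ≤ C := by
  have hp := hπ.prob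
  have hprob := fun t => isProbabilityMeasure_chainLaw (K := K) (Measure.dirac x₀) t
  have hsupp := fun t => finitelySupported_chainLaw hK x₀ t
  -- Convergence in distribution only tests bounded functions, so `f` is truncated at `N` and
  -- monotone convergence removes the truncation. `V` need not be integrable under `π`.
  have htr0 : ∀ (N : ℕ) x, 0 ≤ min (f x) N := fun N x => le_min (hf x) (Nat.cast_nonneg N)
  have htrN : ∀ (N : ℕ) x, |min (f x) N| ≤ N := fun N x => by
    rw [abs_of_nonneg (htr0 N x)]; exact min_le_right _ _
  have htr : ∀ N : ℕ, ∫ x, min (f x) N ∂π ≤ C := by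
    intro N
    let F : X →ᵇ ℝ := BoundedContinuousFunction.ofNormedAddCommGroup (fun x => min (f x) (N : ℝ))
      continuous_of_discreteTopology N (htrN N)
    -- The telescoped drift controls time averages only, hence the passage to Cesàro means.
    have h1 := (hπ.tendsto (Measure.dirac x₀) inferInstance F).cesaro
    have h2 : Tendsto (fun T : ℕ => (T : ℝ)⁻¹ * V x₀ + C) atTop (𝓝 (0 * V x₀ + C)) :=
      ((tendsto_inv_atTop_nhds_zero_nat (𝕜 := ℝ)).mul_const _).add_const _
    rw [zero_mul, zero_add] at h2
    refine le_of_tendsto_of_tendsto h1 h2 ?_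
    filter_upwards [eventually_gt_atTop 0] with T hT
    have hT' : (0 : ℝ) < T := by exact_mod_cast hT
    have h3 := sum_integral_chainLaw_le hK hV hd x₀ T
    have h4 : ∑ t ∈ Finset.range T, ∫ x, F x ∂(chainLaw K (Measure.dirac x₀) t)
        ≤ ∑ t ∈ Finset.range T, ∫ x, f x ∂(chainLaw K (Measure.dirac x₀) t) :=
      Finset.sum_le_sum fun t _ => by
        have := hprob t
        exact integral_mono ((hsupp t).integrable _) ((hsupp t).integrable _)
          fun x => min_le_left _ _
    rw [inv_mul_le_iff₀ hT', mul_add, ← mul_assoc, mul_inv_cancel₀ hT'.ne', one_mul]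
    exact h4.trans h3
  have hC : 0 ≤ C := by
    have := htr 0
    simpa [hf] using this
  have hlin : ∫⁻ x, ENNReal.ofReal (f x) ∂π ≤ ENNReal.ofReal C := by
    have h1 : ∀ x, ENNReal.ofReal (f x) = ⨆ N : ℕ, ENNReal.ofReal (min (f x) N) := by
      intro x
      refine le_antisymm ?_ (iSup_le fun N => ENNReal.ofReal_le_ofReal (min_le_left _ _))
      obtain ⟨N, hN⟩ := exists_nat_ge (f x)
      exact le_iSup_of_le N (by rw [min_eq_left hN])
    simp_rw [h1]
    rw [lintegral_iSup (f := fun (N : ℕ) x => ENNReal.ofReal (min (f x) N))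
      (fun N => Measurable.of_discrete) (fun N M hNM x =>
        ENNReal.ofReal_le_ofReal (min_le_min_left _ (Nat.cast_le.mpr hNM)))]
    refine iSup_le fun N => ?_
    rw [← ofReal_integral_eq_lintegral_ofReal (integrable_of_abs_le (htrN N))
      (Eventually.of_forall (htr0 N))]
    exact ENNReal.ofReal_le_ofReal (htr N)
  have hint : Integrable f π :=
    ⟨(Measurable.of_discrete).aestronglyMeasurable, by
      rw [hasFiniteIntegral_iff_ofReal (Eventually.of_forall hf)]
      exact hlin.trans_lt ENNReal.ofReal_lt_top⟩
  refine ⟨hint, ?_⟩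
  rw [← ofReal_integral_eq_lintegral_ofReal hint (Eventually.of_forall hf)] at hlin
  exact (ENNReal.ofReal_le_ofReal_iff hC).mp hlin

/-- Stationarity in expectation. -/
theorem ProbabilityTheory.Kernel.Invariant.integral_integral {π : Measure X} (hπ : K.Invariant π)
    {f : X → ℝ} (hf : Integrable f π) :
    Integrable (fun x => ∫ y, f y ∂(K x)) π ∧ ∫ x, ∫ y, f y ∂(K x) ∂π = ∫ x, f x ∂π := by
  have hf' : Integrable f (π.bind K) := by rwa [hπ.def]
  refine ⟨?_, ?_⟩
  · rw [Measure.comp_eq_comp_const_apply] at hf'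
    simpa using hf'.integral_comp
  · rw [← integral_bind_of_integrable hf', hπ.def]

end MarkovChain

/-! ### Saturated rows and columns: projection, cone, and the capacity region -/

section Geometry

/-- The Euclidean space `ℝ^(n²)`. -/
abbrev MatSpace (n : ℕ) : Type := EuclideanSpace ℝ (Fin n × Fin n)

variable {n : ℕ}

/-- A matrix as a vector of the Euclidean space. -/
noncomputable def toMat (x : Fin n → Fin n → ℝ) : MatSpace n := WithLp.toLp 2 fun p => x p.1 p.2

/-- A matrix of natural numbers as a vector of the Euclidean space. -/
noncomputable def ofPort (q : PortMatrix n) : MatSpace n := toMat fun i j => (q i j : ℝ)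

@[simp] theorem toMat_apply (x : Fin n → Fin n → ℝ) (p : Fin n × Fin n) :
    toMat x p = x p.1 p.2 := rfl

@[simp] theorem ofPort_apply (q : PortMatrix n) (p : Fin n × Fin n) :
    ofPort q p = q p.1 p.2 := rfl

theorem inner_eq_sum (x y : MatSpace n) : inner ℝ x y = ∑ p, x p * y p := by
  simp [PiLp.inner_apply, mul_comm]

theorem inner_toMat (x y : Fin n → Fin n → ℝ) : inner ℝ (toMat x) (toMat y) = matInner x y := by
  rw [inner_eq_sum, Fintype.sum_prod_type]
  rfl

theorem norm_toMat (x : Fin n → Fin n → ℝ) : ‖toMat x‖ = matNorm x := by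
  rw [matNorm, ← inner_toMat, real_inner_self_eq_norm_sq, Real.sqrt_sq (norm_nonneg _)]

theorem abs_apply_le_norm (x : MatSpace n) (p : Fin n × Fin n) : |x p| ≤ ‖x‖ := by
  simpa using PiLp.norm_apply_le x p

theorem norm_le_card_mul {x : MatSpace n} {c : ℝ} (hc : ∀ p, |x p| ≤ c) :
    ‖x‖ ≤ n * c := by
  rcases n.eq_zero_or_pos with rfl | hn
  · simp [EuclideanSpace.norm_eq]
  have hc0 : 0 ≤ c := (abs_nonneg _).trans (hc (⟨0, hn⟩, ⟨0, hn⟩))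
  refine abs_le_of_sq_le_sq' ?_ (by positivity) |>.2
  rw [EuclideanSpace.norm_sq_eq]
  calc ∑ p, ‖x p‖ ^ 2 ≤ ∑ p : Fin n × Fin n, c ^ 2 :=
        Finset.sum_le_sum fun p _ => pow_le_pow_left₀ (norm_nonneg _) (hc p) 2
    _ = _ := by simp; ring

/-- The indicator of a row. -/
noncomputable def rowInd (i : Fin n) : MatSpace n := toMat fun i' _ => if i' = i then 1 else 0

/-- The indicator of a column. -/
noncomputable def colInd (j : Fin n) : MatSpace n := toMat fun _ j' => if j' = j then 1 else 0

theorem inner_rowInd (i : Fin n) (x : MatSpace n) : inner ℝ (rowInd i) x = ∑ j, x (i, j) := by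
  rw [inner_eq_sum, Fintype.sum_prod_type, Finset.sum_eq_single i] <;>
    simp +contextual [rowInd]

theorem inner_colInd (j : Fin n) (x : MatSpace n) : inner ℝ (colInd j) x = ∑ i, x (i, j) := by
  rw [inner_eq_sum, Fintype.sum_prod_type_right, Finset.sum_eq_single j] <;>
    simp +contextual [colInd]

/-- The space spanned by the indicators of the saturated rows and columns. -/
noncomputable def satSpace (n n1 n2 : ℕ) : Submodule ℝ (MatSpace n) :=
  Submodule.span ℝ ({x | ∃ i : Fin n, (i : ℕ) < n1 ∧ rowInd i = x} ∪
    {x | ∃ j : Fin n, (j : ℕ) < n2 ∧ colInd j = x})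

variable {n1 n2 : ℕ}

theorem rowInd_mem_satSpace {i : Fin n} (hi : (i : ℕ) < n1) : rowInd i ∈ satSpace n n1 n2 :=
  Submodule.subset_span (Or.inl ⟨i, hi, rfl⟩)

theorem colInd_mem_satSpace {j : Fin n} (hj : (j : ℕ) < n2) : colInd j ∈ satSpace n n1 n2 :=
  Submodule.subset_span (Or.inr ⟨j, hj, rfl⟩)

theorem apply_eq_zero_of_mem_satSpace {x : MatSpace n} (hx : x ∈ satSpace n n1 n2)
    {p : Fin n × Fin n} (h1 : n1 ≤ (p.1 : ℕ)) (h2 : n2 ≤ (p.2 : ℕ)) : x p = 0 := by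
  induction hx using Submodule.span_induction with
  | mem x hx =>
    rcases hx with ⟨i, hi, rfl⟩ | ⟨j, hj, rfl⟩
    · have : p.1 ≠ i := fun h => by subst h; omega
      simp [rowInd, this]
    · have : p.2 ≠ j := fun h => by subst h; omega
      simp [colInd, this]
  | zero => simp
  | add x y _ _ hx hy => simp [hx, hy]
  | smul a x _ hx => simp [hx]

/-- The spanning indicators see a matrix only through its saturated line sums. Consequently `ν` and
every perfect matching agree when tested against the space, and so do `α` and `n k`. -/
theorem inner_eq_of_mem_satSpace {x y z : MatSpace n} (hx : x ∈ satSpace n n1 n2)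
    (hr : ∀ i : Fin n, (i : ℕ) < n1 → ∑ j, y (i, j) = ∑ j, z (i, j))
    (hc : ∀ j : Fin n, (j : ℕ) < n2 → ∑ i, y (i, j) = ∑ i, z (i, j)) :
    inner ℝ x y = inner ℝ x z := by
  induction hx using Submodule.span_induction with
  | mem x hx =>
    rcases hx with ⟨i, hi, rfl⟩ | ⟨j, hj, rfl⟩
    · rw [inner_rowInd, inner_rowInd, hr i hi]
    · rw [inner_colInd, inner_colInd, hc j hj]
  | zero => simp
  | add x y _ _ hx hy => rw [inner_add_left, inner_add_left, hx, hy]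
  | smul a x _ hx => rw [inner_smul_left, inner_smul_left, hx]

/-- The projection on the space of saturated rows and columns. -/
noncomputable abbrev satProj (n n1 n2 : ℕ) : MatSpace n →L[ℝ] MatSpace n :=
  (satSpace n n1 n2).starProjection

theorem satProj_mem (x : MatSpace n) : satProj n n1 n2 x ∈ satSpace n n1 n2 :=
  Submodule.starProjection_apply_mem _ _

theorem inner_satProj_left (x y : MatSpace n) :
    inner ℝ (satProj n n1 n2 x) y = inner ℝ x (satProj n n1 n2 y) :=
  Submodule.inner_starProjection_left_eq_right _ _ _

theorem satProj_of_mem {x : MatSpace n} (hx : x ∈ satSpace n n1 n2) : satProj n n1 n2 x = x :=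
  Submodule.starProjection_eq_self_iff.mpr hx

theorem norm_satProj_sq (x : MatSpace n) :
    ‖satProj n n1 n2 x‖ ^ 2 = inner ℝ (satProj n n1 n2 x) x := by
  rw [← real_inner_self_eq_norm_sq, inner_satProj_left (satProj n n1 n2 x) x |>.symm,
    satProj_of_mem (satProj_mem x)]

theorem satProj_eq_of_sums {y z : MatSpace n}
    (hr : ∀ i : Fin n, (i : ℕ) < n1 → ∑ j, y (i, j) = ∑ j, z (i, j))
    (hc : ∀ j : Fin n, (j : ℕ) < n2 → ∑ i, y (i, j) = ∑ i, z (i, j)) :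
    satProj n n1 n2 y = satProj n n1 n2 z := by
  refine ext_inner_left ℝ fun x => ?_
  rw [← inner_satProj_left, ← inner_satProj_left]
  exact inner_eq_of_mem_satSpace (satProj_mem x) hr hc

theorem norm_sub_satProj_le {x y : MatSpace n} (hy : y ∈ satSpace n n1 n2) :
    ‖x - satProj n n1 n2 x‖ ≤ ‖x - y‖ := by
  have h : x - y = (x - satProj n n1 n2 x) + (satProj n n1 n2 x - y) := by abel
  have h1 : inner ℝ (x - satProj n n1 n2 x) (satProj n n1 n2 x - y) = 0 :=
    Submodule.starProjection_inner_eq_zero _ _ (Submodule.sub_mem _ (satProj_mem x) hy)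
  have h2 := norm_add_sq_real (x - satProj n n1 n2 x) (satProj n n1 n2 x - y)
  rw [← h, h1] at h2
  refine abs_le_of_sq_le_sq' ?_ (norm_nonneg _) |>.2
  nlinarith [sq_nonneg ‖satProj n n1 n2 x - y‖]

theorem sum_ite_val_lt {m : ℕ} (hm : m ≤ n) (c : ℝ) :
    ∑ i : Fin n, (if (i : ℕ) < m then c else 0) = m * c := by
  rw [Fin.sum_univ_eq_sum_range (fun i => if i < m then c else 0) n, ← Finset.sum_filter,
    Finset.sum_const, nsmul_eq_mul]
  congr 2
  rw [show Finset.filter (fun i => i < m) (Finset.range n) = Finset.range m by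
    ext i; simp; omega]
  simp

/-- The diagonal of the projection on the space of saturated rows and columns. -/
theorem satProj_single_apply (hn1 : n1 < n) (hn2 : n2 < n) (i j : Fin n) :
    satProj n n1 n2 (EuclideanSpace.single (i, j) 1) (i, j) = zeta n n1 n2 i j / n := by
  have hn : (0 : ℝ) < n := by exact_mod_cast (Nat.zero_le _).trans_lt hn1
  have hn1' : (n1 : ℝ) < n := by exact_mod_cast hn1
  have hn2' : (n2 : ℝ) < n := by exact_mod_cast hn2
  have hΔ : (0 : ℝ) < (n : ℝ) ^ 2 - n1 * n2 := by
    have h1 : (0 : ℝ) ≤ n1 := Nat.cast_nonneg _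
    have h2 : (0 : ℝ) ≤ n2 := Nat.cast_nonneg _
    nlinarith
  -- The projection of the unit matrix at `(i, j)` is sought as row weights `w` plus column weights
  -- `v`. Equal saturated line sums mean `n w i' + U = [i' = i]` and `n v j' + W = [j' = j]`, where
  -- `W` and `U` are the total saturated row and column weights. Summing gives `n W + n1 U = R` and
  -- `n U + n2 W = C`, a system of determinant `n² - n1 n2`.
  set R : ℝ := if (i : ℕ) < n1 then 1 else 0 with hR
  set C : ℝ := if (j : ℕ) < n2 then 1 else 0 with hC
  set W : ℝ := (n * R - n1 * C) / ((n : ℝ) ^ 2 - n1 * n2) with hW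
  set U : ℝ := (n * C - n2 * R) / ((n : ℝ) ^ 2 - n1 * n2) with hU
  have hWΔ : W * ((n : ℝ) ^ 2 - n1 * n2) = n * R - n1 * C := div_mul_cancel₀ _ hΔ.ne'
  have hUΔ : U * ((n : ℝ) ^ 2 - n1 * n2) = n * C - n2 * R := div_mul_cancel₀ _ hΔ.ne'
  set w : Fin n → ℝ := fun i' => ((if i' = i then 1 else 0) - U) / n with hw
  set v : Fin n → ℝ := fun j' => ((if j' = j then 1 else 0) - W) / n with hv
  set y : MatSpace n := toMat fun i' j' =>
    (if (i' : ℕ) < n1 then w i' else 0) + (if (j' : ℕ) < n2 then v j' else 0) with hy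
  have hsw : ∑ i' : Fin n, (if (i' : ℕ) < n1 then w i' else 0) = W := by
    have : ∀ i' : Fin n, (if (i' : ℕ) < n1 then w i' else 0)
        = (if i' = i then R / n else 0) - (if (i' : ℕ) < n1 then U / n else 0) := by
      intro i'
      by_cases h1 : (i' : ℕ) < n1 <;> by_cases h2 : i' = i
      · subst h2; simp [h1, hw, hR, sub_div]
      · simp [h1, h2, hw, sub_div]
      · subst h2; simp [h1, hR]
      · simp [h1, h2]
    simp_rw [this]
    rw [Finset.sum_sub_distrib, sum_ite_val_lt hn1.le]
    simp only [Finset.sum_ite_eq', Finset.mem_univ, if_true]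
    rw [← mul_div_assoc, ← sub_div, div_eq_iff hn.ne']
    refine mul_right_cancel₀ hΔ.ne' ?_
    linear_combination (-(n1 : ℝ)) * hUΔ - n * hWΔ
  have hsv : ∑ j' : Fin n, (if (j' : ℕ) < n2 then v j' else 0) = U := by
    have : ∀ j' : Fin n, (if (j' : ℕ) < n2 then v j' else 0)
        = (if j' = j then C / n else 0) - (if (j' : ℕ) < n2 then W / n else 0) := by
      intro j'
      by_cases h1 : (j' : ℕ) < n2 <;> by_cases h2 : j' = j
      · subst h2; simp [h1, hv, hC, sub_div]
      · simp [h1, h2, hv, sub_div]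
      · subst h2; simp [h1, hC]
      · simp [h1, h2]
    simp_rw [this]
    rw [Finset.sum_sub_distrib, sum_ite_val_lt hn2.le]
    simp only [Finset.sum_ite_eq', Finset.mem_univ, if_true]
    rw [← mul_div_assoc, ← sub_div, div_eq_iff hn.ne']
    refine mul_right_cancel₀ hΔ.ne' ?_
    linear_combination (-(n2 : ℝ)) * hWΔ - n * hUΔ
  have hymem : y ∈ satSpace n n1 n2 := by
    have : y = ∑ i' : Fin n, (if (i' : ℕ) < n1 then w i' else 0) • rowInd i'
        + ∑ j' : Fin n, (if (j' : ℕ) < n2 then v j' else 0) • colInd j' := by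
      ext p
      simp only [hy, PiLp.add_apply, WithLp.ofLp_sum, Finset.sum_apply, PiLp.smul_apply,
        smul_eq_mul, rowInd, colInd, toMat_apply, mul_ite, mul_one, mul_zero, Finset.sum_ite_eq,
        Finset.mem_univ, if_true]
    rw [this]
    refine Submodule.add_mem _ (Submodule.sum_mem _ fun i' _ => ?_)
      (Submodule.sum_mem _ fun j' _ => ?_)
    · split_ifs with h
      · exact Submodule.smul_mem _ _ (rowInd_mem_satSpace h)
      · simp
    · split_ifs with h
      · exact Submodule.smul_mem _ _ (colInd_mem_satSpace h)
      · simp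
  have hproj : satProj n n1 n2 (EuclideanSpace.single (i, j) 1) = y := by
    rw [← satProj_of_mem hymem]
    refine satProj_eq_of_sums (fun i' hi' => ?_) (fun j' hj' => ?_)
    · simp only [hy, toMat_apply, if_pos hi', Finset.sum_add_distrib, hsv]
      by_cases h : i' = i
      · subst h
        simp [hw]
        field_simp
        ring
      · simp [hw, h]
        field_simp
        ring
    · simp only [hy, toMat_apply, if_pos hj', Finset.sum_add_distrib, hsw]
      by_cases h : j' = j
      · subst h
        simp [hv]
        field_simp
        ring
      · simp [hv, h]
        field_simp
        ring
  rw [hproj]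
  simp only [hy, toMat_apply, zeta]
  by_cases h1 : (i : ℕ) < n1 <;> by_cases h2 : (j : ℕ) < n2 <;>
    simp only [h1, h2, if_true, if_false, hw, hv, hU, hW, hR, hC] <;> field_simp <;> ring

/-- The cone of nonnegative matrices in the space of saturated rows and columns. -/
def satCone (n n1 n2 : ℕ) : Set (MatSpace n) := {x | x ∈ satSpace n n1 n2 ∧ ∀ p, 0 ≤ x p}

theorem isClosed_satCone : IsClosed (satCone n n1 n2) := by
  have h : {x : MatSpace n | ∀ p, 0 ≤ x p} = ⋂ p, {x | 0 ≤ x p} := by ext; simp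
  have h' : IsClosed {x : MatSpace n | ∀ p, 0 ≤ x p} :=
    h ▸ isClosed_iInter fun p => isClosed_le continuous_const (by fun_prop)
  exact IsClosed.inter (Submodule.closed_of_finiteDimensional _) h'

theorem convex_satCone : Convex ℝ (satCone n n1 n2) := by
  intro x hx y hy a b ha hb _
  refine ⟨Submodule.add_mem _ (Submodule.smul_mem _ _ hx.1) (Submodule.smul_mem _ _ hy.1),
    fun p => ?_⟩
  have h1 := mul_nonneg ha (hx.2 p)
  have h2 := mul_nonneg hb (hy.2 p)
  simp only [PiLp.add_apply, PiLp.smul_apply, smul_eq_mul]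
  linarith

theorem zero_mem_satCone : (0 : MatSpace n) ∈ satCone n n1 n2 := ⟨Submodule.zero_mem _, by simp⟩

theorem add_mem_satCone {x y : MatSpace n} (hx : x ∈ satCone n n1 n2) (hy : y ∈ satCone n n1 n2) :
    x + y ∈ satCone n n1 n2 :=
  ⟨Submodule.add_mem _ hx.1 hy.1, fun p => add_nonneg (hx.2 p) (hy.2 p)⟩

theorem rowInd_mem_satCone {i : Fin n} (hi : (i : ℕ) < n1) : rowInd i ∈ satCone n n1 n2 :=
  ⟨rowInd_mem_satSpace hi, fun p => by simp only [rowInd, toMat_apply]; split_ifs <;> simp⟩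

theorem colInd_mem_satCone {j : Fin n} (hj : (j : ℕ) < n2) : colInd j ∈ satCone n n1 n2 :=
  ⟨colInd_mem_satSpace hj, fun p => by simp only [colInd, toMat_apply]; split_ifs <;> simp⟩

/-- The nearest point of the cone. -/
theorem exists_nearest_satCone (q : MatSpace n) : ∃ p ∈ satCone n n1 n2,
    Metric.infDist q (satCone n n1 n2) = ‖q - p‖ ∧ inner ℝ (q - p) p = 0 ∧
      ∀ v ∈ satCone n n1 n2, inner ℝ (q - p) v ≤ 0 := by
  have hne : (satCone n n1 n2).Nonempty := ⟨0, zero_mem_satCone⟩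
  obtain ⟨p, hp, hpd⟩ := isClosed_satCone.exists_infDist_eq_dist hne q
  rw [dist_eq_norm] at hpd
  have hinf : ‖q - p‖ = ⨅ w : satCone n n1 n2, ‖q - w‖ := by
    rw [← hpd, Metric.infDist_eq_iInf]
    simp [dist_eq_norm]
  -- On a cone the variational inequality can be tested at `p + v` and at `0`: the first puts `q -
  -- p` in the polar cone, the second gives orthogonality to `p`.
  have h := (norm_eq_iInf_iff_real_inner_le_zero convex_satCone hp).mp hinf
  have hv : ∀ v ∈ satCone n n1 n2, inner ℝ (q - p) v ≤ 0 := fun v hv => by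
    have := h (p + v) (add_mem_satCone hp hv)
    simpa using this
  refine ⟨p, hp, hpd, le_antisymm (hv p hp) ?_, hv⟩
  have := h 0 zero_mem_satCone
  rw [zero_sub, inner_neg_right] at this
  linarith

/-- The row deficits `r` and column deficits `c` have the same total, so the rank-one matrix `r i *
c j / ∑ r` fills both. If the total is zero, the matrix is already doubly stochastic. -/
theorem doublySubstochastic_le {x : Fin n → Fin n → ℝ} (hx : x ∈ capacityRegion n) :
    ∃ M ∈ doublyStochastic ℝ (Fin n), ∀ i j, x i j ≤ M i j := by
  obtain ⟨h0, hr, hc⟩ := hx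
  set r : Fin n → ℝ := fun i => 1 - ∑ j, x i j with hr'
  set c : Fin n → ℝ := fun j => 1 - ∑ i, x i j with hc'
  have hr0 : ∀ i, 0 ≤ r i := fun i => sub_nonneg.mpr (hr i)
  have hc0 : ∀ j, 0 ≤ c j := fun j => sub_nonneg.mpr (hc j)
  have hrc : ∑ i, r i = ∑ j, c j := by
    simp only [hr', hc', Finset.sum_sub_distrib]
    rw [Finset.sum_comm]
  rcases (Finset.sum_nonneg fun i _ => hr0 i : 0 ≤ ∑ i, r i).eq_or_lt with hz | hpos
  · have hri : ∀ i, r i = 0 := fun i =>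
      (Finset.sum_eq_zero_iff_of_nonneg fun i _ => hr0 i).mp hz.symm i (Finset.mem_univ i)
    have hci : ∀ j, c j = 0 := fun j =>
      (Finset.sum_eq_zero_iff_of_nonneg fun i _ => hc0 i).mp (hrc ▸ hz.symm) j (Finset.mem_univ j)
    refine ⟨x, mem_doublyStochastic_iff_sum.mpr ⟨h0, fun i => ?_, fun j => ?_⟩, fun _ _ => le_rfl⟩
    · have := hri i; simp only [hr'] at this; linarith
    · have := hci j; simp only [hc'] at this; linarith
  · refine ⟨fun i j => x i j + r i * c j / ∑ i, r i, mem_doublyStochastic_iff_sum.mpr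
      ⟨fun i j => ?_, fun i => ?_, fun j => ?_⟩, fun i j => ?_⟩
    · exact add_nonneg (h0 i j) (div_nonneg (mul_nonneg (hr0 i) (hc0 j)) hpos.le)
    · rw [Finset.sum_add_distrib, ← Finset.sum_div, ← Finset.mul_sum, ← hrc,
        mul_div_assoc, div_self hpos.ne']
      simp [hr']
    · rw [Finset.sum_add_distrib, ← Finset.sum_div, ← Finset.sum_mul, mul_comm,
        mul_div_assoc, div_self hpos.ne']
      simp [hc']
    · exact le_add_of_nonneg_right (div_nonneg (mul_nonneg (hr0 i) (hc0 j)) hpos.le)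

/-- The weight of a MaxWeight schedule is maximal over the capacity region. -/
theorem inner_le_of_maxWeight {q s : PortMatrix n}
    (hs : ∀ s' ∈ schedules n, scheduleWeight q s' ≤ scheduleWeight q s)
    {x : Fin n → Fin n → ℝ} (hx : x ∈ capacityRegion n) :
    inner ℝ (ofPort q) (toMat x) ≤ inner ℝ (ofPort q) (ofPort s) := by
  -- Since `q` is nonnegative, replacing `x` by a larger `M` only raises the weight; Birkhoff–von
  -- Neumann then writes `M` as a mixture of permutation matrices, which are feasible schedules.
  obtain ⟨M, hM, hxM⟩ := doublySubstochastic_le hx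
  obtain ⟨w, hw0, hw1, hwM⟩ := exists_eq_sum_perm_of_mem_doublyStochastic hM
  have hW : ∀ s : PortMatrix n, inner ℝ (ofPort q) (ofPort s) = (scheduleWeight q s : ℝ) := by
    intro s
    rw [ofPort, ofPort, inner_toMat]
    simp [matInner, scheduleWeight]
  have hperm : ∀ σ : Equiv.Perm (Fin n),
      ∑ i, ∑ j, (q i j : ℝ) * σ.permMatrix ℝ i j ≤ scheduleWeight q s := by
    intro σ
    have h1 : (fun i j => if σ i = j then 1 else 0 : PortMatrix n) ∈ schedules n := by
      refine ⟨fun i j => by by_cases h : σ i = j <;> simp [h], fun i => by simp, fun j => ?_⟩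
      simp only [← Equiv.eq_symm_apply]
      simp
    have h2 := hs _ h1
    have h3 : ∑ i, ∑ j, (q i j : ℝ) * σ.permMatrix ℝ i j
        = (scheduleWeight q (fun i j => if σ i = j then 1 else 0) : ℝ) := by
      simp [scheduleWeight, Equiv.Perm.permMatrix, PEquiv.toMatrix_apply]
    rw [h3]
    exact_mod_cast h2
  rw [hW, ofPort, inner_toMat]
  calc matInner (fun i j => (q i j : ℝ)) x ≤ ∑ i, ∑ j, (q i j : ℝ) * M i j :=
        Finset.sum_le_sum fun i _ => Finset.sum_le_sum fun j _ =>
          mul_le_mul_of_nonneg_left (hxM i j) (Nat.cast_nonneg _)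
    _ = ∑ σ : Equiv.Perm (Fin n), w σ * ∑ i, ∑ j, (q i j : ℝ) * σ.permMatrix ℝ i j := by
        rw [← hwM]
        simp only [Matrix.sum_apply, Matrix.smul_apply, smul_eq_mul, Finset.mul_sum]
        symm
        rw [Finset.sum_comm]
        refine Finset.sum_congr rfl fun i _ => ?_
        rw [Finset.sum_comm]
        refine Finset.sum_congr rfl fun j _ => Finset.sum_congr rfl fun σ _ => ?_
        ring
    _ ≤ ∑ σ : Equiv.Perm (Fin n), w σ * (scheduleWeight q s : ℝ) :=
        Finset.sum_le_sum fun σ _ => mul_le_mul_of_nonneg_left (hperm σ) (hw0 σ)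
    _ = _ := by rw [← Finset.sum_mul, hw1, one_mul]

/-- The line through `y` and `x` stays in the affine span, where `x` is an interior point, so the
segment from `y` can be prolonged a little beyond `x`. -/
theorem exists_add_smul_sub_mem_of_mem_intrinsicInterior {V : Type*} [NormedAddCommGroup V]
    [NormedSpace ℝ V] {s : Set V} {x y : V} (hx : x ∈ intrinsicInterior ℝ s) (hy : y ∈ s) :
    ∃ t > (0 : ℝ), x + t • (x - y) ∈ s := by
  obtain ⟨z, hz, rfl⟩ := mem_intrinsicInterior.mp hx
  have hmem : ∀ t : ℝ, (z : V) + t • ((z : V) - y) ∈ affineSpan ℝ s := by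
    intro t
    have := AffineSubspace.vadd_mem_of_mem_direction
      (Submodule.smul_mem _ t (AffineSubspace.vsub_mem_direction z.2 (subset_affineSpan ℝ s hy))) z.2
    simpa [add_comm] using this
  let c : ℝ → affineSpan ℝ s := fun t => ⟨(z : V) + t • ((z : V) - y), hmem t⟩
  have hc : Continuous c := by
    refine Continuous.subtype_mk (by fun_prop) _
  have hc0 : c 0 = z := Subtype.ext (by simp [c])
  have h1 : ∀ᶠ t in 𝓝 (0 : ℝ), c t ∈ interior ((↑) ⁻¹' s : Set (affineSpan ℝ s)) :=
    hc.continuousAt.eventually_mem (by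
      rw [hc0]
      exact isOpen_interior.mem_nhds hz)
  obtain ⟨t, ht, ht0⟩ := ((h1.filter_mono (nhdsWithin_le_nhds (s := Set.Ioi 0))).and
    self_mem_nhdsWithin).exists
  have h2 : c t ∈ ((↑) ⁻¹' s : Set (affineSpan ℝ s)) := interior_subset ht
  exact ⟨t, ht0, h2⟩

/-- Unsaturated rows and columns are not tight in the relative interior of the face. -/
theorem slack_of_mem_intrinsicInterior (hn1 : n1 < n) (hn2 : n2 < n) {ν : Fin n → Fin n → ℝ}
    (hν : ν ∈ intrinsicInterior ℝ (saturatedFace n n1 n2)) :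
    (∀ i : Fin n, n1 ≤ (i : ℕ) → ∑ j, ν i j < 1) ∧
      (∀ j : Fin n, n2 ≤ (j : ℕ) → ∑ i, ν i j < 1) := by
  have hn : (0 : ℝ) < n := by exact_mod_cast (Nat.zero_le _).trans_lt hn1
  have hn1' : (n1 : ℝ) < n := by exact_mod_cast hn1
  have hn2' : (n2 : ℝ) < n := by exact_mod_cast hn2
  -- A point of the face with slack on every unsaturated line: the sums there are `n2 / n` and `n1 /
  -- n`. If `ν` were tight on such a line, prolonging the segment from `x` beyond `ν` would leave
  -- the capacity region.
  set x : Fin n → Fin n → ℝ := fun i j =>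
    if (i : ℕ) < n1 then 1 / n else if (j : ℕ) < n2 then 1 / n else 0 with hx
  have hrow : ∀ i : Fin n, (i : ℕ) < n1 → ∑ j, x i j = 1 := fun i hi => by
    simp [hx, hi, hn.ne']
  have hrow' : ∀ i : Fin n, n1 ≤ (i : ℕ) → ∑ j, x i j = n2 / n := fun i hi => by
    simp only [hx, not_lt.mpr hi, if_false]
    rw [sum_ite_val_lt hn2.le, mul_one_div]
  have hcol : ∀ j : Fin n, (j : ℕ) < n2 → ∑ i, x i j = 1 := fun j hj => by
    simp [hx, hj, hn.ne']
  have hcol' : ∀ j : Fin n, n2 ≤ (j : ℕ) → ∑ i, x i j = n1 / n := fun j hj => by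
    simp only [hx, not_lt.mpr hj, if_false]
    rw [sum_ite_val_lt hn1.le, mul_one_div]
  have hd1 : (n1 : ℝ) / n < 1 := (div_lt_one hn).mpr hn1'
  have hd2 : (n2 : ℝ) / n < 1 := (div_lt_one hn).mpr hn2'
  have hxF : x ∈ saturatedFace n n1 n2 := by
    refine ⟨⟨fun i j => ?_, fun i => ?_, fun j => ?_⟩, hrow, hcol⟩
    · simp only [hx]
      split_ifs <;> positivity
    · rcases lt_or_ge (i : ℕ) n1 with h | h
      · exact (hrow i h).le
      · exact (hrow' i h).trans_le hd2.le
    · rcases lt_or_ge (j : ℕ) n2 with h | h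
      · exact (hcol j h).le
      · exact (hcol' j h).trans_le hd1.le
  obtain ⟨t, ht, hmem⟩ := exists_add_smul_sub_mem_of_mem_intrinsicInterior hν hxF
  refine ⟨fun i hi => ?_, fun j hj => ?_⟩
  · have h := hmem.1.2.1 i
    simp only [Pi.add_apply, Pi.smul_apply, Pi.sub_apply, smul_eq_mul, Finset.sum_add_distrib,
      ← Finset.mul_sum, Finset.sum_sub_distrib, hrow' i hi] at h
    by_contra hc
    nlinarith
  · have h := hmem.1.2.2 j
    simp only [Pi.add_apply, Pi.smul_apply, Pi.sub_apply, smul_eq_mul, Finset.sum_add_distrib,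
      ← Finset.mul_sum, Finset.sum_sub_distrib, hcol' j hj] at h
    by_contra hc
    nlinarith

theorem nuMin'_pos (hn1 : n1 < n) (hn2 : n2 < n) {ν : Fin n → Fin n → ℝ}
    (hpos : ∀ i j, 0 < ν i j) (hr : ∀ i : Fin n, n1 ≤ (i : ℕ) → ∑ j, ν i j < 1)
    (hc : ∀ j : Fin n, n2 ≤ (j : ℕ) → ∑ i, ν i j < 1) : 0 < nuMin' n1 n2 ν := by
  -- An infimum over an empty index type would be `0`, which would spoil positivity; `n1 < n` and
  -- `n2 < n` exclude this.
  have : Nonempty {i : Fin n // n1 ≤ (i : ℕ)} := ⟨⟨⟨n1, hn1⟩, le_rfl⟩⟩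
  have : Nonempty {j : Fin n // n2 ≤ (j : ℕ)} := ⟨⟨⟨n2, hn2⟩, le_rfl⟩⟩
  have : Nonempty (Fin n × Fin n) := ⟨(⟨n1, hn1⟩, ⟨n2, hn2⟩)⟩
  refine lt_min ?_ (lt_min ?_ ?_)
  · obtain ⟨p, hp⟩ := exists_eq_ciInf_of_finite (f := fun p : Fin n × Fin n => ν p.1 p.2)
    rw [← hp]
    exact hpos _ _
  · obtain ⟨i, hi⟩ := exists_eq_ciInf_of_finite
      (f := fun i : {i : Fin n // n1 ≤ (i : ℕ)} => (1 - ∑ j, ν i j))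
    rw [← hi]
    exact sub_pos.mpr (hr _ i.2)
  · obtain ⟨i, hi⟩ := exists_eq_ciInf_of_finite
      (f := fun j : {j : Fin n // n2 ≤ (j : ℕ)} => (1 - ∑ i, ν i j))
    rw [← hi]
    exact sub_pos.mpr (hc _ i.2)

theorem nuMin'_le (ν : Fin n → Fin n → ℝ) :
    (∀ i j, nuMin' n1 n2 ν ≤ ν i j) ∧
      (∀ i : Fin n, n1 ≤ (i : ℕ) → nuMin' n1 n2 ν ≤ 1 - ∑ j, ν i j) ∧
      (∀ j : Fin n, n2 ≤ (j : ℕ) → nuMin' n1 n2 ν ≤ 1 - ∑ i, ν i j) := by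
  refine ⟨fun i j => ?_, fun i hi => ?_, fun j hj => ?_⟩
  · exact (min_le_left _ _).trans (ciInf_le (f := fun p : Fin n × Fin n => ν p.1 p.2)
      (Set.finite_range _).bddBelow (i, j))
  · exact (min_le_right _ _).trans ((min_le_left _ _).trans (ciInf_le
      (f := fun i : {i : Fin n // n1 ≤ (i : ℕ)} => (1 - ∑ j, ν i j))
      (Set.finite_range _).bddBelow ⟨i, hi⟩))
  · exact (min_le_right _ _).trans ((min_le_right _ _).trans (ciInf_le
      (f := fun j : {j : Fin n // n2 ≤ (j : ℕ)} => (1 - ∑ i, ν i j))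
      (Set.finite_range _).bddBelow ⟨j, hj⟩))

end Geometry

/-! ### One-step dynamics and the drift of the fourth power of a distance -/

section Dynamics

variable {n : ℕ}

theorem switchKernel_apply (φ : Kernel (PortMatrix n) (PortMatrix n)) (A : Measure (PortMatrix n))
    (q : PortMatrix n) : switchKernel φ A q =
      ((φ q).prod A).map fun p => queueUpdate q p.1 p.2 := rfl

theorem integral_switchKernel (φ : Kernel (PortMatrix n) (PortMatrix n))
    (A : Measure (PortMatrix n)) (q : PortMatrix n) (f : PortMatrix n → ℝ) :
    ∫ q', f q' ∂(switchKernel φ A q) = ∫ p, f (queueUpdate q p.1 p.2) ∂((φ q).prod A) := by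
  rw [switchKernel_apply, integral_map (Measurable.of_discrete).aemeasurable
    (Measurable.of_discrete).aestronglyMeasurable]

variable {φ : Kernel (PortMatrix n) (PortMatrix n)} {A : Measure (PortMatrix n)} {amax : ℕ}
  {rate : Fin n → Fin n → ℝ}

theorem ae_step (hφ : IsMaxWeight φ) (hA : IsArrivalLaw A amax rate) (q : PortMatrix n) :
    ∀ᵐ p ∂((φ q).prod A), (p.1 ∈ maximalSchedules n ∧
      ∀ s' ∈ schedules n, scheduleWeight q s' ≤ scheduleWeight q p.1) ∧ ∀ i j, p.2 i j ≤ amax := by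
  have := hφ.markov
  have := hA.prob
  have h1 := Measure.quasiMeasurePreserving_fst (μ := φ q) (ν := A) |>.ae
    ((hφ.maximal q).and (hφ.maxWeight q))
  have h2 := Measure.quasiMeasurePreserving_snd (μ := φ q) (ν := A) |>.ae hA.bounded
  exact h1.and h2

theorem finitelySupported_step (hφ : IsMaxWeight φ) (hA : IsArrivalLaw A amax rate)
    (q : PortMatrix n) : FinitelySupported ((φ q).prod A) := by
  refine ⟨Set.Icc 0 (fun _ _ => 1) ×ˢ Set.Icc 0 (fun _ _ => amax),
    (Set.finite_Icc _ _).prod (Set.finite_Icc _ _), ?_⟩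
  have h : ∀ᵐ p ∂((φ q).prod A), p ∈ (Set.Icc 0 (fun _ _ => 1) ×ˢ Set.Icc 0 (fun _ _ => amax) :
      Set (PortMatrix n × PortMatrix n)) := by
    filter_upwards [ae_step hφ hA q] with p hp
    refine ⟨⟨fun i j => Nat.zero_le _, fun i j => ?_⟩, ⟨fun i j => Nat.zero_le _, hp.2⟩⟩
    rcases hp.1.1.1 i j with h | h <;> simp [h]
  exact ae_iff.mp h

theorem finitelySupported_switchKernel (hφ : IsMaxWeight φ) (hA : IsArrivalLaw A amax rate)
    (q : PortMatrix n) : FinitelySupported (switchKernel φ A q) := by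
  obtain ⟨F, hF, h0⟩ := finitelySupported_step hφ hA q
  refine ⟨(fun p => queueUpdate q p.1 p.2) '' F, hF.image _, ?_⟩
  rw [switchKernel_apply, Measure.map_apply Measurable.of_discrete MeasurableSet.of_discrete]
  refine measure_mono_null (fun p hp hpF => hp (Set.mem_image_of_mem _ hpF)) h0

theorem integrable_step (hφ : IsMaxWeight φ) (hA : IsArrivalLaw A amax rate)
    (q : PortMatrix n) (f : PortMatrix n × PortMatrix n → ℝ) :
    Integrable f ((φ q).prod A) := by
  have := hφ.markov
  have := hA.prob
  exact (finitelySupported_step hφ hA q).integrable f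

theorem finitelySupported_arrival (hA : IsArrivalLaw A amax rate) : FinitelySupported A :=
  ⟨Set.Icc 0 (fun _ _ => amax), Set.finite_Icc _ _, by
    have h : ∀ᵐ a ∂A, a ∈ (Set.Icc 0 (fun _ _ => amax) : Set (PortMatrix n)) := by
      filter_upwards [hA.bounded] with a ha
      exact ⟨fun i j => Nat.zero_le _, ha⟩
    exact ae_iff.mp h⟩

theorem integrable_arrival (hA : IsArrivalLaw A amax rate) (f : PortMatrix n → ℝ) :
    Integrable f A := by
  have := hA.prob
  exact (finitelySupported_arrival hA).integrable f

theorem integral_inner_arrival (hA : IsArrivalLaw A amax rate) (v : MatSpace n) :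
    ∫ a, inner ℝ v (ofPort a) ∂A = inner ℝ v (toMat rate) := by
  simp_rw [inner_eq_sum]
  rw [integral_finsetSum _ fun p _ => integrable_arrival hA _]
  refine Finset.sum_congr rfl fun p _ => ?_
  rw [integral_const_mul]
  congr 1
  exact hA.mean p.1 p.2

/-- The unused service: the part of the schedule which finds an empty queue. -/
noncomputable def unusedService (q s a : PortMatrix n) : MatSpace n :=
  ofPort (queueUpdate q s a) - (ofPort q + (ofPort a - ofPort s))

theorem ofPort_queueUpdate (q s a : PortMatrix n) :
    ofPort (queueUpdate q s a) = ofPort q + (ofPort a - ofPort s) + unusedService q s a := by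
  simp [unusedService]

/-- Truncation acts only where a served queue has `q + a = 0`. The vanishing of `q` gives the sign
in the distance drift; the vanishing of the updated queue drives the heavy traffic estimate. -/
theorem unusedService_apply {q s a : PortMatrix n} (hs : s ∈ maximalSchedules n)
    (p : Fin n × Fin n) :
    unusedService q s a p = 0 ∨ (unusedService q s a p = 1 ∧ q p.1 p.2 = 0 ∧
      queueUpdate q s a p.1 p.2 = 0) := by
  have h := hs.1 p.1 p.2
  simp only [unusedService, PiLp.sub_apply, PiLp.add_apply, ofPort_apply, queueUpdate]
  rcases h with h | h
  · left
    simp [h]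
  · rw [h]
    rcases Nat.eq_zero_or_pos (q p.1 p.2 + a p.1 p.2) with h0 | h0
    · right
      have h1 : q p.1 p.2 = 0 := by omega
      have h2 : a p.1 p.2 = 0 := by omega
      simp [h1, h2]
    · left
      rw [Nat.cast_sub h0]
      push_cast
      ring

theorem sum_row_ofPort {s : PortMatrix n} (hs : s ∈ maximalSchedules n) (i : Fin n) :
    ∑ j, ofPort s (i, j) = 1 := by
  simp only [ofPort_apply]
  exact_mod_cast hs.2.1 i

theorem sum_col_ofPort {s : PortMatrix n} (hs : s ∈ maximalSchedules n) (j : Fin n) :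
    ∑ i, ofPort s (i, j) = 1 := by
  simp only [ofPort_apply]
  exact_mod_cast hs.2.2 j

/-- Unused service lives where `q` is zero, so only `-x` contributes. This is why the target sets
consist of nonnegative matrices. -/
theorem inner_unusedService_nonpos {q s a : PortMatrix n} (hs : s ∈ maximalSchedules n)
    {x : MatSpace n} (hx : ∀ p, 0 ≤ x p) :
    inner ℝ (ofPort q - x) (unusedService q s a) ≤ 0 := by
  rw [inner_eq_sum]
  refine Finset.sum_nonpos fun p _ => ?_
  rcases unusedService_apply (a := a) (q := q) hs p with h | ⟨h, hq, -⟩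
  · simp [h]
  · simp [h, hq, hx p]

theorem norm_arrival_sub_schedule_le {s a : PortMatrix n} (hs : s ∈ maximalSchedules n)
    (ha : ∀ i j, a i j ≤ amax) : ‖ofPort a - ofPort s‖ ≤ n * (amax + 1 : ℝ) := by
  refine norm_le_card_mul fun p => ?_
  have h1 : (a p.1 p.2 : ℝ) ≤ amax := by exact_mod_cast ha p.1 p.2
  have h2 : (0 : ℝ) ≤ a p.1 p.2 := Nat.cast_nonneg _
  simp only [PiLp.sub_apply, ofPort_apply, abs_le]
  rcases hs.1 p.1 p.2 with h | h <;> rw [h] <;> push_cast <;> constructor <;> linarith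

theorem norm_increment_le {q s a : PortMatrix n} (hs : s ∈ maximalSchedules n)
    (ha : ∀ i j, a i j ≤ amax) :
    ‖ofPort a - ofPort s + unusedService q s a‖ ≤ n * (amax + 1 : ℝ) := by
  refine norm_le_card_mul fun p => ?_
  have h1 : (a p.1 p.2 : ℝ) ≤ amax := by exact_mod_cast ha p.1 p.2
  have h2 : (0 : ℝ) ≤ a p.1 p.2 := Nat.cast_nonneg _
  have e : (ofPort a - ofPort s + unusedService q s a) p
      = (queueUpdate q s a p.1 p.2 : ℝ) - q p.1 p.2 := by
    simp only [unusedService, PiLp.sub_apply, PiLp.add_apply, ofPort_apply]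
    ring
  have h3 : queueUpdate q s a p.1 p.2 ≤ q p.1 p.2 + amax := by
    have := ha p.1 p.2
    simp only [queueUpdate]
    omega
  have h4 : q p.1 p.2 ≤ queueUpdate q s a p.1 p.2 + 1 := by
    simp only [queueUpdate]
    rcases hs.1 p.1 p.2 with h | h <;> rw [h] <;> omega
  have h3' : (queueUpdate q s a p.1 p.2 : ℝ) ≤ q p.1 p.2 + amax := by exact_mod_cast h3
  have h4' : (q p.1 p.2 : ℝ) ≤ queueUpdate q s a p.1 p.2 + 1 := by exact_mod_cast h4
  have h5 : (0 : ℝ) ≤ amax := Nat.cast_nonneg _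
  rw [e, abs_le]
  constructor <;> linarith

/-- The constant of the drift inequality for fourth powers of distances. -/
noncomputable def driftConst (δ L : ℝ) : ℝ :=
  (8 * L ^ 2 + 1) * ((8 * L ^ 2 + 1) / (4 * δ)) ^ 2 + 3 * L ^ 4

/-- Bounding `4 L³ W` by `2 L² W² + 2 L⁴` reduces the claim to `(8 L² + 1) W² - 4 δ W³` being
bounded. The cubic term wins once `W` reaches `(8 L² + 1) / (4 δ)`, the threshold in `driftConst`.
-/
theorem quartic_le_driftConst {δ L W : ℝ} (hδ : 0 < δ) (hW : 0 ≤ W) :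
    W ^ 4 + 2 * W ^ 2 * (2 * (-δ * W) + L ^ 2) + (2 * L * W + L ^ 2) ^ 2
      ≤ W ^ 4 - W ^ 2 + driftConst δ L := by
  have h1 : (8 * L ^ 2 + 1) * W ^ 2 - 4 * δ * W ^ 3
      ≤ (8 * L ^ 2 + 1) * ((8 * L ^ 2 + 1) / (4 * δ)) ^ 2 := by
    have hc : 0 < 8 * L ^ 2 + 1 := by positivity
    rcases le_total ((8 * L ^ 2 + 1) / (4 * δ)) W with h | h
    · have h2 : 8 * L ^ 2 + 1 ≤ W * (4 * δ) := (div_le_iff₀ (by positivity)).mp h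
      have h3 : (8 * L ^ 2 + 1) * W ^ 2 ≤ W * (4 * δ) * W ^ 2 :=
        mul_le_mul_of_nonneg_right h2 (sq_nonneg W)
      have h4 : 0 ≤ (8 * L ^ 2 + 1) * ((8 * L ^ 2 + 1) / (4 * δ)) ^ 2 := by positivity
      nlinarith
    · have h2 : W ^ 2 ≤ ((8 * L ^ 2 + 1) / (4 * δ)) ^ 2 := pow_le_pow_left₀ hW h 2
      have h3 := mul_le_mul_of_nonneg_left h2 hc.le
      have h4 : 0 ≤ 4 * δ * W ^ 3 := by positivity
      linarith
  have h2 : 0 ≤ 2 * L ^ 2 * (W - L) ^ 2 := by positivity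
  rw [driftConst]
  nlinarith

/-- The drift of the fourth power of the distance of the queue lengths to a set of nonnegative
matrices. -/
theorem integral_infDist_pow_four_le (hφ : IsMaxWeight φ) (hA : IsArrivalLaw A amax rate)
    {C : Set (MatSpace n)} {δ : ℝ} (hδ : 0 < δ) (hC : ∀ x ∈ C, ∀ p, 0 ≤ x p)
    {q : PortMatrix n} {x : MatSpace n} (hx : x ∈ C)
    (hdist : Metric.infDist (ofPort q) C = ‖ofPort q - x‖)
    (hdrift : ∀ s ∈ maximalSchedules n,
      (∀ s' ∈ schedules n, scheduleWeight q s' ≤ scheduleWeight q s) →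
      inner ℝ (ofPort q - x) (toMat rate - ofPort s) ≤ -δ * ‖ofPort q - x‖) :
    ∫ q', Metric.infDist (ofPort q') C ^ 4 ∂(switchKernel φ A q)
      ≤ Metric.infDist (ofPort q) C ^ 4 - Metric.infDist (ofPort q) C ^ 2
        + driftConst δ (n * (amax + 1)) := by
  have := hφ.markov
  have := hA.prob
  set L : ℝ := n * (amax + 1) with hL
  have hL0 : 0 ≤ L := by positivity
  set d : MatSpace n := ofPort q - x with hd
  set W : ℝ := Metric.infDist (ofPort q) C with hW
  have hW0 : 0 ≤ W := Metric.infDist_nonneg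
  have hint := integrable_step hφ hA q
  rw [integral_switchKernel]
  -- The squared distance grows by at most `2 X + L²` with `X = ⟨d, a - s⟩`, the unused service
  -- having the favourable sign. Squaring keeps `4 W² X` to be averaged, and `|X| ≤ W L` controls
  -- the remaining term.
  have hpt : ∀ᵐ p ∂((φ q).prod A), Metric.infDist (ofPort (queueUpdate q p.1 p.2)) C ^ 4
      ≤ 4 * W ^ 2 * inner ℝ d (ofPort p.2 - ofPort p.1)
        + (W ^ 4 + 2 * W ^ 2 * L ^ 2 + (2 * L * W + L ^ 2) ^ 2) := by
    filter_upwards [ae_step hφ hA q] with p hp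
    set X : ℝ := inner ℝ d (ofPort p.2 - ofPort p.1) with hX
    have h1 : Metric.infDist (ofPort (queueUpdate q p.1 p.2)) C
        ≤ ‖d + (ofPort p.2 - ofPort p.1 + unusedService q p.1 p.2)‖ := by
      refine (Metric.infDist_le_dist_of_mem hx).trans_eq ?_
      rw [dist_eq_norm, ofPort_queueUpdate, hd]
      congr 1
      abel
    have h2 : Metric.infDist (ofPort (queueUpdate q p.1 p.2)) C ^ 2 ≤ W ^ 2 + 2 * X + L ^ 2 := by
      refine (pow_le_pow_left₀ Metric.infDist_nonneg h1 2).trans ?_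
      rw [norm_add_sq_real, inner_add_right, hdist]
      have h3 := inner_unusedService_nonpos (q := q) (a := p.2) hp.1.1 (hC x hx)
      have h4 := pow_le_pow_left₀ (norm_nonneg _) (norm_increment_le (q := q) hp.1.1 hp.2) 2
      linarith
    have h3 : |X| ≤ W * L := by
      rw [hdist]
      exact (abs_real_inner_le_norm _ _).trans (mul_le_mul_of_nonneg_left
        (norm_arrival_sub_schedule_le hp.1.1 hp.2) (norm_nonneg _))
    have h4 : (2 * X + L ^ 2) ^ 2 ≤ (2 * L * W + L ^ 2) ^ 2 := by
      refine sq_le_sq' ?_ ?_ <;> nlinarith [abs_le.mp h3, sq_nonneg L]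
    have h5 := pow_le_pow_left₀ (sq_nonneg _) h2 2
    nlinarith
  refine (integral_mono_ae (hint _) (hint _) hpt).trans ?_
  have hX : ∫ p, inner ℝ d (ofPort p.2 - ofPort p.1) ∂((φ q).prod A) ≤ -δ * W := by
    have e1 : ∫ p, inner ℝ d (ofPort p.2) ∂((φ q).prod A) = inner ℝ d (toMat rate) := by
      rw [integral_fun_snd (fun a => inner ℝ d (ofPort a)), integral_inner_arrival hA]
      simp
    have e2 : ∫ p, inner ℝ d (ofPort p.2 - ofPort p.1) ∂((φ q).prod A)
        = ∫ p, inner ℝ d (toMat rate - ofPort p.1) ∂((φ q).prod A) := by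
      simp_rw [inner_sub_right]
      rw [integral_sub (hint _) (hint _), integral_sub (hint _) (hint _), e1]
      simp
    rw [e2]
    calc _ ≤ ∫ p, -δ * W ∂((φ q).prod A) := by
          refine integral_mono_ae (hint _) (hint _) ?_
          filter_upwards [ae_step hφ hA q] with p hp
          rw [hdist]
          exact hdrift _ hp.1.1 hp.1.2
      _ = _ := by simp
  rw [integral_add (hint _) (hint _), integral_const_mul]
  have h6 := mul_le_mul_of_nonneg_left hX (by positivity : 0 ≤ 4 * W ^ 2)
  have h7 := quartic_le_driftConst (L := L) hδ hW0
  simp only [integral_const, probReal_univ, one_smul]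
  linarith

end Dynamics

/-! ### Positive recurrence and state space collapse -/

section SteadyState

variable {n : ℕ} {φ : Kernel (PortMatrix n) (PortMatrix n)} {A : Measure (PortMatrix n)} {amax : ℕ}
  {rate : Fin n → Fin n → ℝ}

theorem rate_nonneg (hA : IsArrivalLaw A amax rate) (i j : Fin n) : 0 ≤ rate i j := by
  rw [← hA.mean i j]
  exact integral_nonneg fun a => Nat.cast_nonneg _

/-- An entry that is almost surely at least one would have mean at least one. Independence
multiplies the positive probabilities of a zero, so a slot without any arrival is possible. -/
theorem arrival_zero_ne_zero (hA : IsArrivalLaw A amax rate) (hrate : ∀ i j, rate i j < 1) :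
    A {0} ≠ 0 := by
  have := hA.prob
  have h1 := hA.indep.measure_inter_preimage_eq_mul Finset.univ (sets := fun _ => {0})
    (fun _ _ => MeasurableSet.of_discrete)
  have h2 : (⋂ p ∈ (Finset.univ : Finset (Fin n × Fin n)),
      (fun a : PortMatrix n => a p.1 p.2) ⁻¹' {0}) = {0} := by
    ext a
    simp only [Finset.mem_univ, Set.iInter_true, Set.mem_iInter, Set.mem_preimage,
      Set.mem_singleton_iff, Prod.forall]
    exact ⟨fun h => funext fun i => funext fun j => h i j, fun h i j => by rw [h]; rfl⟩
  rw [h2] at h1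
  rw [h1, Finset.prod_ne_zero_iff]
  rintro ⟨i, j⟩ - h0
  have h3 : ∀ᵐ a ∂A, (1 : ℝ) ≤ a i j := by
    rw [ae_iff]
    refine measure_mono_null (fun a ha => ?_) h0
    simp only [Set.mem_ofPred_eq, not_le] at ha
    have : a i j < 1 := by exact_mod_cast ha
    simpa using this
  have h4 : ∫ _, (1 : ℝ) ∂A ≤ ∫ a, (a i j : ℝ) ∂A :=
    integral_mono_ae (integrable_const _) (integrable_arrival hA _) h3
  rw [hA.mean i j] at h4
  simp only [integral_const, probReal_univ, one_smul] at h4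
  linarith [hrate i j]

theorem exists_schedule (hφ : IsMaxWeight φ) (q : PortMatrix n) :
    ∃ s, φ q {s} ≠ 0 ∧ s ∈ maximalSchedules n ∧
      ∀ s' ∈ schedules n, scheduleWeight q s' ≤ scheduleWeight q s := by
  have := hφ.markov
  have h1 := ae_iff_of_countable.mp ((hφ.maximal q).and (hφ.maxWeight q))
  by_contra hcon
  have h2 : ∀ᵐ s ∂(φ q), False := by
    rw [ae_iff_of_countable]
    exact fun s hs => hcon ⟨s, hs, h1 s hs⟩
  simp at h2
  exact IsProbabilityMeasure.ne_zero _ h2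

/-- Serving one nonempty queue alone is feasible and has positive weight, so the maximal weight is
positive and some nonempty queue is served. -/
theorem exists_pos_of_maxWeight {q s : PortMatrix n} (hq : q ≠ 0)
    (hs : ∀ s' ∈ schedules n, scheduleWeight q s' ≤ scheduleWeight q s) :
    ∃ i j, 0 < q i j ∧ 0 < s i j := by
  obtain ⟨i, j, hij⟩ : ∃ i j, q i j ≠ 0 := by
    by_contra h
    push Not at h
    exact hq (funext fun i => funext fun j => h i j)
  have hmem : (fun i' j' => if i' = i ∧ j' = j then 1 else 0 : PortMatrix n) ∈ schedules n := by
    refine ⟨fun i' j' => by by_cases h : i' = i ∧ j' = j <;> simp [h], fun i' => ?_, fun j' => ?_⟩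
    · by_cases h : i' = i <;> simp [h]
    · by_cases h : j' = j <;> simp [h]
  have h1 := hs _ hmem
  have h2 : q i j ≤ scheduleWeight q (fun i' j' => if i' = i ∧ j' = j then 1 else 0) := by
    simp [scheduleWeight, ite_and]
  have h3 : scheduleWeight q s ≠ 0 := by omega
  by_contra hcon
  push Not at hcon
  refine h3 (Finset.sum_eq_zero fun i _ => Finset.sum_eq_zero fun j _ => ?_)
  rcases Nat.eq_zero_or_pos (q i j) with h | h
  · simp [h]
  · have := hcon i j h
    simp [Nat.le_zero.mp this]

theorem finite_setOf_norm_ofPort_sq_le (M : ℝ) :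
    {q : PortMatrix n | ‖ofPort q‖ ^ 2 ≤ M}.Finite := by
  refine (Set.finite_Icc (0 : PortMatrix n) (fun _ _ => ⌊M⌋₊)).subset fun q hq =>
    ⟨fun i j => Nat.zero_le _, fun i j => Nat.le_floor ?_⟩
  have h1 := abs_apply_le_norm (ofPort q) (i, j)
  rw [ofPort_apply, Nat.abs_cast] at h1
  have h2 : (q i j : ℝ) ≤ (q i j : ℝ) ^ 2 := by
    exact_mod_cast Nat.le_self_pow two_ne_zero (q i j)
  exact h2.trans ((pow_le_pow_left₀ (Nat.cast_nonneg _) h1 2).trans hq)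

/-- The MaxWeight schedule beats the shifted point `x + c d`. Room to move from `x` in direction `d`
is thereby turned into drift. -/
theorem inner_sub_le_of_shift_mem {q s : PortMatrix n}
    (hs : ∀ s' ∈ schedules n, scheduleWeight q s' ≤ scheduleWeight q s)
    {x : Fin n → Fin n → ℝ} {d : MatSpace n} {c : ℝ}
    (h : (fun i j => x i j + c * d (i, j)) ∈ capacityRegion n) :
    inner ℝ (ofPort q) (toMat x - ofPort s) ≤ -c * inner ℝ (ofPort q) d := by
  have h1 := inner_le_of_maxWeight hs h
  have h2 : toMat (fun i j => x i j + c * d (i, j)) = toMat x + c • d := by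
    ext p
    simp
  rw [h2, inner_add_right, inner_smul_right] at h1
  rw [inner_sub_right]
  linarith

theorem abs_sum_le_mul_norm (d : MatSpace n) (f : Fin n → Fin n × Fin n) :
    |∑ j, d (f j)| ≤ n * ‖d‖ :=
  (Finset.abs_sum_le_sum_abs _ _).trans
    ((Finset.sum_le_sum fun j _ => abs_apply_le_norm d (f j)).trans (by simp))

/-- Positive recurrence of the queue lengths when the arrival rates are interior. -/
theorem exists_isSteadyState (hφ : IsMaxWeight φ) (hA : IsArrivalLaw A amax rate)
    {η : ℝ} (hη : 0 < η) (hrow : ∀ i, ∑ j, rate i j ≤ 1 - η) (hcol : ∀ j, ∑ i, rate i j ≤ 1 - η) :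
    ∃ π, IsSteadyState (switchKernel φ A) π ∧ Integrable (fun q => ‖ofPort q‖ ^ 2) π := by
  have := hφ.markov
  have := hA.prob
  have : IsMarkovKernel (switchKernel φ A) := switchKernel_isMarkovKernel φ A
  have hr0 := rate_nonneg hA
  have hr1 : ∀ i j, rate i j < 1 := fun i j => by
    have := Finset.single_le_sum (fun j _ => hr0 i j) (Finset.mem_univ j)
    linarith [hrow i]
  -- A vector of norm `δ` has line sums at most `n δ ≤ η`, so this step length respects the slack.
  -- Dividing by `n + 1` instead of `n` covers `n = 0`.
  set δ : ℝ := η / (n + 1) with hδ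
  have hδ0 : 0 < δ := by positivity
  have hδn : δ * n ≤ η := by
    rw [hδ, div_mul_eq_mul_div, div_le_iff₀ (by positivity)]
    nlinarith
  have hdrift : ∀ q : PortMatrix n,
      ∫ q', ‖ofPort q'‖ ^ 4 ∂(switchKernel φ A q)
        ≤ ‖ofPort q‖ ^ 4 - ‖ofPort q‖ ^ 2 + driftConst δ (n * (amax + 1)) := by
    intro q
    -- With target set `{0}` the distance is the norm, so the general drift bound applies verbatim.
    have h := integral_infDist_pow_four_le (q := q) (x := 0) (C := {0}) hφ hA hδ0 (by simp)
      rfl (by simp) (fun s _ hs => ?_)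
    · simpa using h
    rcases eq_or_ne (ofPort q) 0 with h0 | h0
    · simp [h0]
    have hpos : 0 < ‖ofPort q‖ := norm_pos_iff.mpr h0
    have hc : 0 ≤ δ / ‖ofPort q‖ := by positivity
    have hsum : ∀ f : Fin n → Fin n × Fin n,
        δ / ‖ofPort q‖ * ∑ j, ofPort q (f j) ≤ η := fun f => by
      have h1 := (le_abs_self _).trans (abs_sum_le_mul_norm (ofPort q) f)
      calc _ ≤ δ / ‖ofPort q‖ * (n * ‖ofPort q‖) := mul_le_mul_of_nonneg_left h1 hc
        _ = δ * n := by field_simp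
        _ ≤ η := hδn
    have h1 := inner_sub_le_of_shift_mem hs (x := rate) (d := ofPort q) (c := δ / ‖ofPort q‖)
      ⟨fun i j => add_nonneg (hr0 i j) (mul_nonneg hc (Nat.cast_nonneg _)), fun i => by
        rw [Finset.sum_add_distrib, ← Finset.mul_sum]
        linarith [hrow i, hsum fun j => (i, j)], fun j => by
        rw [Finset.sum_add_distrib, ← Finset.mul_sum]
        linarith [hcol j, hsum fun i => (i, j)]⟩
    rw [real_inner_self_eq_norm_sq] at h1
    rw [sub_zero]
    refine h1.trans_eq ?_
    field_simp
  have hfs := finitelySupported_switchKernel hφ hA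
  choose s hs0 hsmax hsw using exists_schedule hφ
  -- A slot without arrivals and with a MaxWeight schedule of positive probability. It removes at
  -- least one packet until the switch is empty, and the empty state is fixed, which settles both
  -- accessibility and aperiodicity.
  set g : PortMatrix n → PortMatrix n := fun q => queueUpdate q (s q) 0 with hg
  have hgpos : ∀ q, switchKernel φ A q {g q} ≠ 0 := by
    intro q h
    rw [switchKernel_apply, Measure.map_apply Measurable.of_discrete MeasurableSet.of_discrete] at h
    have h1 : (φ q).prod A ({s q} ×ˢ {0}) = 0 := by
      refine measure_mono_null (fun p hp => ?_) h
      simp only [Set.mem_prod, Set.mem_singleton_iff] at hp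
      simp [hp.1, hp.2, hg]
    rw [Measure.prod_prod, mul_eq_zero] at h1
    exact h1.elim (hs0 q) (arrival_zero_ne_zero hA hr1)
  have hgtot : ∀ q, ∑ p : Fin n × Fin n, g q p.1 p.2 ≤ (∑ p : Fin n × Fin n, q p.1 p.2) - 1 := by
    intro q
    have hle : ∀ p : Fin n × Fin n, g q p.1 p.2 ≤ q p.1 p.2 := fun p => by
      simp [hg, queueUpdate]
    rcases eq_or_ne q 0 with rfl | hq
    · have : ∀ p : Fin n × Fin n, g 0 p.1 p.2 = 0 := fun p => by simpa using hle p
      simp [this]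
    · obtain ⟨i, j, hqij, hsij⟩ := exists_pos_of_maxWeight hq (hsw q)
      refine Nat.le_sub_one_of_lt (Finset.sum_lt_sum (fun p _ => hle p) ⟨(i, j), Finset.mem_univ _, ?_⟩)
      simp only [hg, queueUpdate, Pi.zero_apply, add_zero]
      omega
  have hgt : ∀ q t, ∑ p : Fin n × Fin n, g^[t] q p.1 p.2 ≤ (∑ p : Fin n × Fin n, q p.1 p.2) - t := by
    intro q t
    induction t with
    | zero => simp
    | succ t ih =>
      rw [Function.iterate_succ_apply']
      have := hgtot (g^[t] q)
      omega
  have hreach : ∀ q, ∃ m, ∀ t ≥ m, g^[t] q = 0 := fun q =>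
    ⟨∑ p : Fin n × Fin n, q p.1 p.2, fun t ht => by
      have h1 := hgt q t
      rw [Nat.sub_eq_zero_of_le ht, Nat.le_zero, Finset.sum_eq_zero_iff] at h1
      exact funext fun i => funext fun j => h1 (i, j) (Finset.mem_univ _)⟩
  obtain ⟨π, hπ⟩ := exists_isSteadyState_of_drift hfs (V := fun q => ‖ofPort q‖ ^ 4)
    (w := fun q => ‖ofPort q‖ ^ 2) (fun q => by positivity) (fun q => by positivity)
    finite_setOf_norm_ofPort_sq_le hdrift hgpos hreach
  exact ⟨π, hπ, (hπ.integrable_of_drift hfs (fun q => by positivity) (fun q => by positivity)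
    hdrift 0).1⟩

/-- State space collapse: the queue lengths are at bounded distance, in mean square, from the
cone of saturated rows and columns. -/
theorem integral_infDist_satCone_sq_le {n1 n2 : ℕ} {ν k : Fin n → Fin n → ℝ} {ε m : ℝ}
    (hφ : IsMaxWeight φ) (hA : IsArrivalLaw A amax (fun i j => ν i j - ε * k i j))
    (hε : 0 ≤ ε) (hm : 0 < m) (hεm : ε * ‖toMat k‖ ≤ m / (n + 1) / 2)
    (hν0 : ∀ i j, m ≤ ν i j)
    (hrow : ∀ i : Fin n, (i : ℕ) < n1 → ∑ j, ν i j = 1)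
    (hcol : ∀ j : Fin n, (j : ℕ) < n2 → ∑ i, ν i j = 1)
    (hrow' : ∀ i : Fin n, n1 ≤ (i : ℕ) → m ≤ 1 - ∑ j, ν i j)
    (hcol' : ∀ j : Fin n, n2 ≤ (j : ℕ) → m ≤ 1 - ∑ i, ν i j)
    {π : Measure (PortMatrix n)} (hπ : IsSteadyState (switchKernel φ A) π) :
    Integrable (fun q => Metric.infDist (ofPort q) (satCone n n1 n2) ^ 2) π ∧
      ∫ q, Metric.infDist (ofPort q) (satCone n n1 n2) ^ 2 ∂π
        ≤ driftConst (m / (n + 1) / 2) (n * (amax + 1)) := by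
  have := hφ.markov
  have := hA.prob
  have : IsMarkovKernel (switchKernel φ A) := switchKernel_isMarkovKernel φ A
  set δ : ℝ := m / (n + 1) with hδ
  have hδ0 : 0 < δ := by positivity
  have hδm : δ * (n + 1) = m := div_mul_cancel₀ _ (by positivity)
  have hn0 : (0 : ℝ) ≤ n := Nat.cast_nonneg n
  refine hπ.integrable_of_drift (finitelySupported_switchKernel hφ hA)
    (V := fun q => Metric.infDist (ofPort q) (satCone n n1 n2) ^ 4) (fun q => by positivity)
    (fun q => by positivity) (fun q => ?_) 0
  obtain ⟨x, hx, hdist, hxx, hxv⟩ := exists_nearest_satCone (n1 := n1) (n2 := n2) (ofPort q)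
  refine integral_infDist_pow_four_le hφ hA (by positivity) (fun x hx => hx.2) hx hdist
    fun s hs hsw => ?_
  set d : MatSpace n := ofPort q - x with hd
  have hrate : toMat (fun i j => ν i j - ε * k i j) = toMat ν - ε • toMat k := by
    ext p
    simp
  rcases eq_or_ne d 0 with h0 | h0
  · simp [h0]
  have hpos : 0 < ‖d‖ := norm_pos_iff.mpr h0
  have hc : 0 ≤ δ / ‖d‖ := by positivity
  have hent : ∀ p, -δ ≤ δ / ‖d‖ * d p := fun p => by
    have h1 := (abs_le.mp (abs_apply_le_norm d p)).1
    have h2 := mul_le_mul_of_nonneg_left h1 hc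
    rwa [mul_neg, div_mul_cancel₀ _ hpos.ne'] at h2
  have hsum : ∀ f : Fin n → Fin n × Fin n, δ / ‖d‖ * ∑ j, d (f j) ≤ m := fun f => by
    have h1 := (le_abs_self _).trans (abs_sum_le_mul_norm d f)
    calc _ ≤ δ / ‖d‖ * (n * ‖d‖) := mul_le_mul_of_nonneg_left h1 hc
      _ = δ * n := by field_simp
      _ ≤ m := by nlinarith
  -- The shifted matrix stays in the capacity region: entries remain nonnegative as `ν ≥ m ≥ δ`,
  -- saturated sums do not grow because `d` is in the polar cone, and unsaturated sums use the slack
  -- `m`.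
  have h1 := inner_sub_le_of_shift_mem hsw (x := ν) (d := d) (c := δ / ‖d‖)
    ⟨fun i j => by
      have := hent (i, j)
      nlinarith [hν0 i j], fun i => by
      rw [Finset.sum_add_distrib, ← Finset.mul_sum]
      rcases lt_or_ge (i : ℕ) n1 with hi | hi
      · have h2 := hxv _ (rowInd_mem_satCone hi)
        rw [real_inner_comm, inner_rowInd] at h2
        have := mul_nonpos_of_nonneg_of_nonpos hc h2
        linarith [hrow i hi]
      · linarith [hrow' i hi, hsum fun j => (i, j)], fun j => by
      rw [Finset.sum_add_distrib, ← Finset.mul_sum]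
      rcases lt_or_ge (j : ℕ) n2 with hj | hj
      · have h2 := hxv _ (colInd_mem_satCone hj)
        rw [real_inner_comm, inner_colInd] at h2
        have := mul_nonpos_of_nonneg_of_nonpos hc h2
        linarith [hcol j hj]
      · linarith [hcol' j hj, hsum fun i => (i, j)]⟩
  have h2 : inner ℝ (ofPort q) d = ‖d‖ ^ 2 := by
    have : ofPort q = d + x := by simp [hd]
    rw [this, inner_add_left, real_inner_self_eq_norm_sq, real_inner_comm, hxx, add_zero]
  -- The cone component does not distinguish `ν` from `s`, so the drift along `q` is the drift along
  -- `d`.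
  have h3 : inner ℝ x (toMat ν - ofPort s) = 0 := by
    rw [inner_sub_right, sub_eq_zero]
    refine inner_eq_of_mem_satSpace hx.1 (fun i hi => ?_) (fun j hj => ?_)
    · rw [sum_row_ofPort hs]; exact hrow i hi
    · rw [sum_col_ofPort hs]; exact hcol j hj
  have h4 : inner ℝ d (toMat ν - ofPort s) ≤ -δ * ‖d‖ := by
    rw [hd, inner_sub_left, h3, sub_zero]
    refine h1.trans_eq ?_
    rw [h2]
    field_simp
    rw [hd]
  -- The perturbation `ε k` consumes at most half of the drift `δ ‖d‖`, whence the rate `δ / 2`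
  -- independent of `ε`.
  have h5 := neg_le_of_abs_le (abs_real_inner_le_norm d (toMat k))
  rw [hrate, show toMat ν - ε • toMat k - ofPort s = (toMat ν - ofPort s) - ε • toMat k by abel,
    inner_sub_right, inner_smul_right]
  have h6 := mul_le_mul_of_nonneg_left h5 hε
  have h7 := mul_le_mul_of_nonneg_right hεm hpos.le
  linarith

end SteadyState

/-! ### Steady-state balance of linear and quadratic forms -/

section Stationarity

variable {n n1 n2 : ℕ} {φ : Kernel (PortMatrix n) (PortMatrix n)} {A : Measure (PortMatrix n)}
  {amax : ℕ} {rate : Fin n → Fin n → ℝ}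

theorem integral_centered_mul (hA : IsArrivalLaw A amax rate) (p r : Fin n × Fin n) :
    ∫ a, ((a p.1 p.2 : ℝ) - rate p.1 p.2) * ((a r.1 r.2 : ℝ) - rate r.1 r.2) ∂A
      = if p = r then arrivalVariance A p.1 p.2 else 0 := by
  have := hA.prob
  split_ifs with h
  · subst h
    rw [arrivalVariance, variance_eq_integral (integrable_arrival hA _).aemeasurable, hA.mean]
    exact integral_congr_ae (Eventually.of_forall fun a => (pow_two _).symm)
  · have h1 : IndepFun (fun a : PortMatrix n => (a p.1 p.2 : ℝ) - rate p.1 p.2)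
        (fun a => (a r.1 r.2 : ℝ) - rate r.1 r.2) A :=
      (hA.indep.indepFun h).comp (φ := fun x : ℕ => (x : ℝ) - rate p.1 p.2)
        (ψ := fun x : ℕ => (x : ℝ) - rate r.1 r.2) Measurable.of_discrete Measurable.of_discrete
    rw [h1.integral_fun_mul_eq_mul_integral (integrable_arrival hA _).aestronglyMeasurable
      (integrable_arrival hA _).aestronglyMeasurable,
      integral_sub (integrable_arrival hA _) (integrable_const _), hA.mean]
    simp

/-- Independence makes the covariance matrix diagonal, so only the diagonal entries `ζ / n` of the
projection contribute. -/
theorem integral_norm_satProj_centered_sq (hn1 : n1 < n) (hn2 : n2 < n)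
    (hA : IsArrivalLaw A amax rate) :
    ∫ a, ‖satProj n n1 n2 (ofPort a - toMat rate)‖ ^ 2 ∂A
      = matInner (arrivalVariance A) (zeta n n1 n2) / n := by
  have hexp : ∀ y : MatSpace n, ‖satProj n n1 n2 y‖ ^ 2
      = ∑ r, ∑ p, satProj n n1 n2 (EuclideanSpace.single p 1) r * (y p * y r) := by
    intro y
    have h1 : satProj n n1 n2 y = ∑ p, y p • satProj n n1 n2 (EuclideanSpace.single p 1) := by
      have h2 : y = ∑ p, y p • EuclideanSpace.single p (1 : ℝ) := by
        ext r
        simp [Pi.single_apply]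
      conv_lhs => rw [h2]
      rw [map_sum]
      simp_rw [map_smul]
    rw [norm_satProj_sq, inner_eq_sum]
    refine Finset.sum_congr rfl fun r _ => ?_
    conv_lhs => rw [h1]
    rw [WithLp.ofLp_sum, Finset.sum_apply, Finset.sum_mul]
    refine Finset.sum_congr rfl fun p _ => ?_
    rw [PiLp.smul_apply, smul_eq_mul]
    ring
  simp_rw [hexp]
  rw [integral_finsetSum _ fun r _ => integrable_arrival hA _]
  simp_rw [integral_finsetSum _ fun p _ => integrable_arrival hA _, integral_const_mul]
  have h3 : ∀ r p : Fin n × Fin n, ∫ a, (ofPort a - toMat rate) p * (ofPort a - toMat rate) r ∂A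
      = if p = r then arrivalVariance A p.1 p.2 else 0 := fun r p => integral_centered_mul hA p r
  simp_rw [h3]
  simp only [mul_ite, mul_zero, Finset.sum_ite_eq', Finset.mem_univ, if_true]
  rw [Fintype.sum_prod_type, matInner, Finset.sum_div]
  refine Finset.sum_congr rfl fun i _ => ?_
  rw [Finset.sum_div]
  refine Finset.sum_congr rfl fun j _ => ?_
  rw [satProj_single_apply hn1 hn2]
  ring

/-- The sum of the indicators of the saturated rows and columns. -/
noncomputable def satSum (n n1 n2 : ℕ) : MatSpace n :=
  toMat fun i j => (if (i : ℕ) < n1 then 1 else 0) + (if (j : ℕ) < n2 then 1 else 0)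

theorem satSum_mem : satSum n n1 n2 ∈ satSpace n n1 n2 := by
  have : satSum n n1 n2 = ∑ i : Fin n, (if (i : ℕ) < n1 then (1 : ℝ) else 0) • rowInd i
      + ∑ j : Fin n, (if (j : ℕ) < n2 then (1 : ℝ) else 0) • colInd j := by
    ext p
    simp only [satSum, PiLp.add_apply, WithLp.ofLp_sum, Finset.sum_apply, PiLp.smul_apply,
      smul_eq_mul, rowInd, colInd, toMat_apply, mul_ite, mul_one, mul_zero, Finset.sum_ite_eq,
      Finset.mem_univ, if_true]
  rw [this]
  refine Submodule.add_mem _ (Submodule.sum_mem _ fun i' _ => ?_)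
    (Submodule.sum_mem _ fun j' _ => ?_)
  · split_ifs with h
    · exact Submodule.smul_mem _ _ (rowInd_mem_satSpace h)
    · simp
  · split_ifs with h
    · exact Submodule.smul_mem _ _ (colInd_mem_satSpace h)
    · simp

/-- `satSum` is at least one wherever an element of the space can be nonzero, so `⟨satSum, u⟩`
dominates the amount of unused service that the projection can see. -/
theorem apply_eq_zero_or_one_le_satSum {x : MatSpace n} (hx : x ∈ satSpace n n1 n2)
    (p : Fin n × Fin n) : (x p = 0 ∧ 0 ≤ satSum n n1 n2 p) ∨ 1 ≤ satSum n n1 n2 p := by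
  simp only [satSum, toMat_apply]
  rcases lt_or_ge (p.1 : ℕ) n1 with h1 | h1
  · right
    simp only [h1, if_true]
    split_ifs <;> norm_num
  · rcases lt_or_ge (p.2 : ℕ) n2 with h2 | h2
    · right
      simp only [h2, if_true]
      split_ifs <;> norm_num
    · left
      refine ⟨apply_eq_zero_of_mem_satSpace hx h1 h2, ?_⟩
      split_ifs <;> norm_num

/-- Unused service at an entry forces the updated queue to be zero there, so its projection equals
minus the distance component. Then `2 b ≤ θ b² + θ⁻¹` entrywise; the free `θ` is later tuned to `ε`.
-/
theorem abs_inner_satProj_unusedService_le {q s a : PortMatrix n} (hs : s ∈ maximalSchedules n)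
    {θ : ℝ} (hθ : 0 < θ) :
    |2 * inner ℝ (satProj n n1 n2 (ofPort (queueUpdate q s a))) (unusedService q s a)|
      ≤ θ * ‖ofPort (queueUpdate q s a) - satProj n n1 n2 (ofPort (queueUpdate q s a))‖ ^ 2
        + θ⁻¹ * inner ℝ (satSum n n1 n2) (unusedService q s a) := by
  set q' := ofPort (queueUpdate q s a) with hq'
  rw [EuclideanSpace.norm_sq_eq, inner_eq_sum, inner_eq_sum, Finset.mul_sum, Finset.mul_sum,
    Finset.mul_sum, ← Finset.sum_add_distrib]
  refine (Finset.abs_sum_le_sum_abs _ _).trans (Finset.sum_le_sum fun p _ => ?_)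
  have hθ' : 0 < θ⁻¹ := inv_pos.mpr hθ
  have h0 : 0 ≤ θ * ‖(q' - satProj n n1 n2 q') p‖ ^ 2 := by positivity
  rcases unusedService_apply (q := q) (a := a) hs p with h | ⟨h, -, h2⟩
  · simpa [h] using h0
  · rcases apply_eq_zero_or_one_le_satSum (satProj_mem (n1 := n1) (n2 := n2) q') p with
      ⟨h3, h4⟩ | h4
    · rw [h, h3]
      have := mul_nonneg hθ'.le h4
      simp only [mul_zero, abs_zero, mul_one]
      linarith
    · have h5 : (q' - satProj n n1 n2 q') p = -(satProj n n1 n2 q' p) := by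
        simp [hq', h2]
      rw [h, h5, norm_neg, Real.norm_eq_abs, mul_one, mul_one, abs_mul, abs_two]
      set b := |satProj n n1 n2 q' p|
      have h6 := mul_le_mul_of_nonneg_left h4 hθ'.le
      have h7 : 0 ≤ θ⁻¹ * (θ * b - 1) ^ 2 := by positivity
      have h8 : θ⁻¹ * (θ * b - 1) ^ 2 = θ * b ^ 2 - 2 * b + θ⁻¹ := by
        field_simp
        ring
      linarith

/-- `‖P u‖² = ⟨P u, u⟩` and `u` is 0/1-valued, so `2 b ≤ b² + 1` at the visible entries gives twice
the left side at most itself plus the right side. -/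
theorem norm_satProj_unusedService_sq_le {q s a : PortMatrix n} (hs : s ∈ maximalSchedules n) :
    ‖satProj n n1 n2 (unusedService q s a)‖ ^ 2
      ≤ inner ℝ (satSum n n1 n2) (unusedService q s a) := by
  have h1 : 2 * ‖satProj n n1 n2 (unusedService q s a)‖ ^ 2
      ≤ ‖satProj n n1 n2 (unusedService q s a)‖ ^ 2
        + inner ℝ (satSum n n1 n2) (unusedService q s a) := by
    conv_lhs => rw [norm_satProj_sq]
    rw [EuclideanSpace.norm_sq_eq, inner_eq_sum, inner_eq_sum, Finset.mul_sum,
      ← Finset.sum_add_distrib]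
    refine Finset.sum_le_sum fun p _ => ?_
    rcases unusedService_apply (q := q) (a := a) hs p with h | ⟨h, -, -⟩
    · rw [h]
      simp only [mul_zero, add_zero]
      positivity
    · rcases apply_eq_zero_or_one_le_satSum
        (satProj_mem (n1 := n1) (n2 := n2) (unusedService q s a)) p with ⟨h3, h4⟩ | h4
      · rw [h, h3]
        simpa using h4
      · rw [h, Real.norm_eq_abs, sq_abs]
        nlinarith [sq_nonneg ((satProj n n1 n2 (unusedService q s a)) p - 1)]
  linarith

variable {ν k : Fin n → Fin n → ℝ} {ε : ℝ}

theorem toMat_sub_mul (ν k : Fin n → Fin n → ℝ) (ε : ℝ) :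
    toMat (fun i j => ν i j - ε * k i j) = toMat ν - ε • toMat k := by
  ext p
  simp

theorem inner_schedule_eq {s : PortMatrix n} (hs : s ∈ maximalSchedules n)
    (hrow : ∀ i : Fin n, (i : ℕ) < n1 → ∑ j, ν i j = 1)
    (hcol : ∀ j : Fin n, (j : ℕ) < n2 → ∑ i, ν i j = 1)
    {v : MatSpace n} (hv : v ∈ satSpace n n1 n2) :
    inner ℝ v (ofPort s) = inner ℝ v (toMat ν) :=
  inner_eq_of_mem_satSpace hv (fun i hi => by rw [sum_row_ofPort hs]; exact (hrow i hi).symm)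
    (fun j hj => by rw [sum_col_ofPort hs]; exact (hcol j hj).symm)

/-- Tested against the saturated space, the random schedule is the constant `ν`, so the mean
increment does not depend on the queue or on tie breaking. -/
theorem integral_inner_increment (hφ : IsMaxWeight φ)
    (hA : IsArrivalLaw A amax (fun i j => ν i j - ε * k i j))
    (hrow : ∀ i : Fin n, (i : ℕ) < n1 → ∑ j, ν i j = 1)
    (hcol : ∀ j : Fin n, (j : ℕ) < n2 → ∑ i, ν i j = 1)
    {v : MatSpace n} (hv : v ∈ satSpace n n1 n2) (q : PortMatrix n) :
    ∫ p, inner ℝ v (ofPort p.2 - ofPort p.1) ∂((φ q).prod A) = -ε * inner ℝ v (toMat k) := by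
  have := hφ.markov
  have := hA.prob
  have hint := integrable_step hφ hA q
  have h1 : ∀ᵐ p ∂((φ q).prod A), inner ℝ v (ofPort p.2 - ofPort p.1)
      = inner ℝ v (ofPort p.2) - inner ℝ v (toMat ν) := by
    filter_upwards [ae_step hφ hA q] with p hp
    rw [inner_sub_right, inner_schedule_eq hp.1.1 hrow hcol hv]
  rw [integral_congr_ae h1, integral_sub (hint _) (integrable_const _),
    integral_fun_snd (fun a => inner ℝ v (ofPort a)), integral_inner_arrival hA, toMat_sub_mul,
    inner_sub_right, inner_smul_right]
  simp

theorem integrable_of_sq_bound {π : Measure (PortMatrix n)} [IsProbabilityMeasure π]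
    (hπ : Integrable (fun q => ‖ofPort q‖ ^ 2) π) {f : PortMatrix n → ℝ} {c : ℝ}
    (hf : ∀ q, |f q| ≤ c * (1 + ‖ofPort q‖ ^ 2)) : Integrable f π :=
  (((integrable_const 1).add hπ).const_mul c).mono'
    (Measurable.of_discrete).aestronglyMeasurable (Eventually.of_forall hf)

theorem le_one_add_sq (x : ℝ) : x ≤ 1 + x ^ 2 := by nlinarith [sq_nonneg (x - 1)]

theorem integrable_inner {π : Measure (PortMatrix n)} [IsProbabilityMeasure π]
    (hπ : Integrable (fun q => ‖ofPort q‖ ^ 2) π) (v : MatSpace n) :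
    Integrable (fun q => inner ℝ v (ofPort q)) π :=
  integrable_of_sq_bound hπ fun q => (abs_real_inner_le_norm v (ofPort q)).trans
    (mul_le_mul_of_nonneg_left (le_one_add_sq _) (norm_nonneg v))

/-- In steady state the unused service of the saturated ports balances the missing arrivals. -/
theorem integral_inner_unusedService (hφ : IsMaxWeight φ)
    (hA : IsArrivalLaw A amax (fun i j => ν i j - ε * k i j))
    (hrow : ∀ i : Fin n, (i : ℕ) < n1 → ∑ j, ν i j = 1)
    (hcol : ∀ j : Fin n, (j : ℕ) < n2 → ∑ i, ν i j = 1)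
    {π : Measure (PortMatrix n)} (hπ : IsSteadyState (switchKernel φ A) π)
    (hsq : Integrable (fun q => ‖ofPort q‖ ^ 2) π)
    {v : MatSpace n} (hv : v ∈ satSpace n n1 n2) :
    Integrable (fun q => ∫ p, inner ℝ v (unusedService q p.1 p.2) ∂((φ q).prod A)) π ∧
      ∫ q, ∫ p, inner ℝ v (unusedService q p.1 p.2) ∂((φ q).prod A) ∂π
        = ε * inner ℝ v (toMat k) := by
  have := hφ.markov
  have := hA.prob
  have := hπ.prob
  have : IsMarkovKernel (switchKernel φ A) := switchKernel_isMarkovKernel φ A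
  have hlin := integrable_inner hsq v
  obtain ⟨h1, h2⟩ := hπ.invariant.integral_integral hlin
  -- The one-step mean of `⟨v, q⟩` is solved for the unused service; integrating over the stationary
  -- law cancels the two queue terms.
  have h3 : ∀ q, ∫ p, inner ℝ v (unusedService q p.1 p.2) ∂((φ q).prod A)
      = ∫ q', inner ℝ v (ofPort q') ∂(switchKernel φ A q)
        - inner ℝ v (ofPort q) + ε * inner ℝ v (toMat k) := by
    intro q
    have hint := integrable_step hφ hA q
    rw [integral_switchKernel]
    simp_rw [ofPort_queueUpdate, inner_add_right]
    rw [integral_add (hint _) (hint _), integral_add (hint _) (hint _),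
      integral_inner_increment hφ hA hrow hcol hv]
    simp only [integral_const, probReal_univ, one_smul]
    ring
  simp_rw [h3]
  have h4 : Integrable (fun q => ∫ q', inner ℝ v (ofPort q') ∂(switchKernel φ A q)
      - inner ℝ v (ofPort q)) π := h1.sub hlin
  refine ⟨h4.add (integrable_const _), ?_⟩
  rw [integral_add h4 (integrable_const _), integral_sub h1 hlin, h2]
  simp

/-- Since `P s = P ν`, the projected increment is the projected centered arrival minus `ε P k`, and
the cross term has mean zero. -/
theorem integral_norm_satProj_increment_sq (hn1 : n1 < n) (hn2 : n2 < n) (hφ : IsMaxWeight φ)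
    (hA : IsArrivalLaw A amax (fun i j => ν i j - ε * k i j))
    (hrow : ∀ i : Fin n, (i : ℕ) < n1 → ∑ j, ν i j = 1)
    (hcol : ∀ j : Fin n, (j : ℕ) < n2 → ∑ i, ν i j = 1) (q : PortMatrix n) :
    ∫ p, ‖satProj n n1 n2 (ofPort p.2 - ofPort p.1)‖ ^ 2 ∂((φ q).prod A)
      = matInner (arrivalVariance A) (zeta n n1 n2) / n
        + ε ^ 2 * ‖satProj n n1 n2 (toMat k)‖ ^ 2 := by
  have := hφ.markov
  have := hA.prob
  have hint := integrable_arrival hA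
  set rate : Fin n → Fin n → ℝ := fun i j => ν i j - ε * k i j with hrate
  set w : MatSpace n := satProj n n1 n2 (satProj n n1 n2 (toMat k)) with hw
  have h1 : ∀ᵐ p ∂((φ q).prod A), ‖satProj n n1 n2 (ofPort p.2 - ofPort p.1)‖ ^ 2
      = ‖satProj n n1 n2 (ofPort p.2 - toMat rate)‖ ^ 2
        - 2 * ε * (inner ℝ w (ofPort p.2) - inner ℝ w (toMat rate))
        + ε ^ 2 * ‖satProj n n1 n2 (toMat k)‖ ^ 2 := by
    filter_upwards [ae_step hφ hA q] with p hp
    have e1 : satProj n n1 n2 (ofPort p.1) = satProj n n1 n2 (toMat ν) :=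
      satProj_eq_of_sums
        (fun i hi => by rw [sum_row_ofPort hp.1.1]; exact (hrow i hi).symm)
        (fun j hj => by rw [sum_col_ofPort hp.1.1]; exact (hcol j hj).symm)
    have e2 : satProj n n1 n2 (ofPort p.2 - ofPort p.1)
        = satProj n n1 n2 (ofPort p.2 - toMat rate) - ε • satProj n n1 n2 (toMat k) := by
      rw [map_sub, e1, hrate, toMat_sub_mul, map_sub, map_sub, map_smul]
      abel
    rw [e2, norm_sub_sq_real, inner_smul_right, norm_smul, mul_pow, Real.norm_eq_abs, sq_abs,
      inner_satProj_left, ← inner_sub_right, real_inner_comm]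
    ring
  rw [integral_congr_ae h1,
    integral_fun_snd (fun a => ‖satProj n n1 n2 (ofPort a - toMat rate)‖ ^ 2
      - 2 * ε * (inner ℝ w (ofPort a) - inner ℝ w (toMat rate))
      + ε ^ 2 * ‖satProj n n1 n2 (toMat k)‖ ^ 2),
    integral_add (hint _) (hint _), integral_sub (hint _) (hint _), integral_const_mul,
    integral_sub (hint _) (hint _), integral_inner_arrival hA,
    integral_norm_satProj_centered_sq hn1 hn2 hA]
  simp

/-- The balance of the quadratic form of the saturated rows and columns in steady state. -/
theorem abs_integral_inner_satProj_sub_le (hn1 : n1 < n) (hn2 : n2 < n) (hφ : IsMaxWeight φ)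
    (hA : IsArrivalLaw A amax (fun i j => ν i j - ε * k i j))
    (hrow : ∀ i : Fin n, (i : ℕ) < n1 → ∑ j, ν i j = 1)
    (hcol : ∀ j : Fin n, (j : ℕ) < n2 → ∑ i, ν i j = 1)
    {π : Measure (PortMatrix n)} (hπ : IsSteadyState (switchKernel φ A) π)
    (hsq : Integrable (fun q => ‖ofPort q‖ ^ 2) π) {θ : ℝ} (hθ : 0 < θ) :
    |2 * ε * ∫ q, inner ℝ (satProj n n1 n2 (toMat k)) (ofPort q) ∂π
        - (matInner (arrivalVariance A) (zeta n n1 n2) / n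
          + ε ^ 2 * ‖satProj n n1 n2 (toMat k)‖ ^ 2)|
      ≤ θ * ∫ q, ‖ofPort q - satProj n n1 n2 (ofPort q)‖ ^ 2 ∂π
        + (θ⁻¹ + 1) * (ε * inner ℝ (satSum n n1 n2) (toMat k)) := by
  have := hφ.markov
  have := hA.prob
  have := hπ.prob
  have : IsMarkovKernel (switchKernel φ A) := switchKernel_isMarkovKernel φ A
  set P := satProj n n1 n2 with hP
  set c : ℝ := matInner (arrivalVariance A) (zeta n n1 n2) / n + ε ^ 2 * ‖P (toMat k)‖ ^ 2 with hc
  have hproj : ∀ x : MatSpace n, ‖P x‖ ^ 2 + ‖x - P x‖ ^ 2 = ‖x‖ ^ 2 := fun x => by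
    have h := norm_sub_sq_real x (P x)
    rw [real_inner_comm, ← norm_satProj_sq] at h
    linarith
  have hi1 : Integrable (fun q => ‖P (ofPort q)‖ ^ 2) π :=
    integrable_of_sq_bound hsq (c := 1) fun q => by
      rw [abs_of_nonneg (by positivity)]
      nlinarith [hproj (ofPort q), sq_nonneg ‖ofPort q - P (ofPort q)‖]
  have hi2 : Integrable (fun q => ‖ofPort q - P (ofPort q)‖ ^ 2) π :=
    integrable_of_sq_bound hsq (c := 1) fun q => by
      rw [abs_of_nonneg (by positivity)]
      nlinarith [hproj (ofPort q), sq_nonneg ‖P (ofPort q)‖]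
  have hi3 := integrable_inner hsq (P (toMat k))
  obtain ⟨hj1, he1⟩ := hπ.invariant.integral_integral hi1
  obtain ⟨hj2, he2⟩ := hπ.invariant.integral_integral hi2
  obtain ⟨hj3, he3⟩ := integral_inner_unusedService hφ hA hrow hcol hπ hsq
    (satSum_mem (n := n) (n1 := n1) (n2 := n2))
  set R : PortMatrix n → ℝ := fun q =>
    ∫ p, (2 * inner ℝ (P (ofPort (queueUpdate q p.1 p.2))) (unusedService q p.1 p.2)
      - ‖P (unusedService q p.1 p.2)‖ ^ 2) ∂((φ q).prod A) with hR
  have hexp : ∀ q, ∫ q', ‖P (ofPort q')‖ ^ 2 ∂(switchKernel φ A q)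
      = ‖P (ofPort q)‖ ^ 2 - 2 * ε * inner ℝ (P (toMat k)) (ofPort q) + c + R q := by
    intro q
    have hint := integrable_step hφ hA q
    rw [integral_switchKernel]
    -- The cross term with the unused service is taken at the updated queue, not at `q + a - s`;
    -- this flips the sign of `‖P u‖²` and allows `u` to be paired with the queues that vanish.
    have hpt : ∀ p : PortMatrix n × PortMatrix n, ‖P (ofPort (queueUpdate q p.1 p.2))‖ ^ 2
        = ‖P (ofPort q)‖ ^ 2 + 2 * inner ℝ (P (ofPort q)) (ofPort p.2 - ofPort p.1)
          + ‖P (ofPort p.2 - ofPort p.1)‖ ^ 2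
          + (2 * inner ℝ (P (ofPort (queueUpdate q p.1 p.2))) (unusedService q p.1 p.2)
            - ‖P (unusedService q p.1 p.2)‖ ^ 2) := by
      intro p
      have hPP : ∀ x y : MatSpace n, inner ℝ (P x) (P y) = inner ℝ (P x) y := fun x y => by
        rw [← inner_satProj_left, satProj_of_mem (satProj_mem x)]
      have e1 : ∀ y z : MatSpace n, ‖P (y + z)‖ ^ 2
          = ‖P y‖ ^ 2 + 2 * inner ℝ (P y) z + ‖P z‖ ^ 2 := fun y z => by
        rw [map_add, norm_add_sq_real, hPP]
      rw [ofPort_queueUpdate, e1, e1, map_add _ (ofPort q + _), inner_add_left,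
        ← norm_satProj_sq]
      ring
    simp_rw [hpt]
    rw [integral_add (hint _) (hint _), integral_add (hint _) (hint _),
      integral_add (hint _) (hint _), integral_const_mul,
      integral_inner_increment hφ hA hrow hcol (satProj_mem _),
      integral_norm_satProj_increment_sq hn1 hn2 hφ hA hrow hcol, inner_satProj_left,
      real_inner_comm]
    simp only [integral_const, probReal_univ, one_smul, hc, hR]
    ring
  have hRint : Integrable R π := by
    have : R = fun q => ∫ q', ‖P (ofPort q')‖ ^ 2 ∂(switchKernel φ A q)
        - (‖P (ofPort q)‖ ^ 2 - 2 * ε * inner ℝ (P (toMat k)) (ofPort q) + c) := by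
      funext q
      rw [hexp q]
      ring
    rw [this]
    exact hj1.sub ((hi1.sub (hi3.const_mul _)).add (integrable_const _))
  have hbal : 2 * ε * ∫ q, inner ℝ (P (toMat k)) (ofPort q) ∂π - c = ∫ q, R q ∂π := by
    have hi4 : Integrable (fun q => ‖P (ofPort q)‖ ^ 2
        - 2 * ε * inner ℝ (P (toMat k)) (ofPort q)) π := hi1.sub (hi3.const_mul _)
    have hi5 : Integrable (fun q => ‖P (ofPort q)‖ ^ 2
        - 2 * ε * inner ℝ (P (toMat k)) (ofPort q) + c) π := hi4.add (integrable_const _)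
    simp_rw [hexp] at he1
    rw [integral_add hi5 hRint, integral_add hi4 (integrable_const _),
      integral_sub hi1 (hi3.const_mul _), integral_const_mul] at he1
    simp only [integral_const, probReal_univ, one_smul] at he1
    linarith
  rw [hbal]
  -- The bound involves the queue after one step; integrating over the stationary law turns it back
  -- into a mean under `π`.
  have hRb : ∀ q, |R q| ≤
      θ * ∫ q', ‖ofPort q' - P (ofPort q')‖ ^ 2 ∂(switchKernel φ A q)
      + (θ⁻¹ + 1) * ∫ p, inner ℝ (satSum n n1 n2) (unusedService q p.1 p.2) ∂((φ q).prod A) := by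
    intro q
    have hint := integrable_step hφ hA q
    rw [integral_switchKernel, ← integral_const_mul, ← integral_const_mul,
      ← integral_add (hint _) (hint _)]
    refine abs_integral_le_integral_abs.trans (integral_mono_ae (hint _) (hint _) ?_)
    filter_upwards [ae_step hφ hA q] with p hp
    have h1 := abs_inner_satProj_unusedService_le (n1 := n1) (n2 := n2) (q := q) (a := p.2)
      hp.1.1 hθ
    have h2 := norm_satProj_unusedService_sq_le (n1 := n1) (n2 := n2) (q := q) (a := p.2) hp.1.1
    refine (abs_sub _ _).trans ?_
    rw [abs_of_nonneg (sq_nonneg ‖P (unusedService q p.1 p.2)‖)]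
    linarith
  calc |∫ q, R q ∂π| ≤ ∫ q, |R q| ∂π := abs_integral_le_integral_abs
    _ ≤ ∫ q, (θ * ∫ q', ‖ofPort q' - P (ofPort q')‖ ^ 2 ∂(switchKernel φ A q)
      + (θ⁻¹ + 1) * ∫ p, inner ℝ (satSum n n1 n2) (unusedService q p.1 p.2) ∂((φ q).prod A)) ∂π :=
        integral_mono hRint.abs ((hj2.const_mul _).add (hj3.const_mul _)) hRb
    _ = _ := by
        rw [integral_add (hj2.const_mul _) (hj3.const_mul _), integral_const_mul,
          integral_const_mul, he2, he3]

end Stationarity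

/-! ### Heavy traffic estimates -/

section HeavyTraffic

variable {n n1 n2 : ℕ} {φ : Kernel (PortMatrix n) (PortMatrix n)} {A : Measure (PortMatrix n)}
  {amax : ℕ} {ν k : Fin n → Fin n → ℝ} {ε : ℝ}

/-- The cone lies in the subspace, so the distance to the subspace is no larger than the distance to
the cone. -/
theorem integral_norm_sub_satProj_sq_le {π : Measure (PortMatrix n)} {D : ℝ}
    (hint : Integrable (fun q => Metric.infDist (ofPort q) (satCone n n1 n2) ^ 2) π)
    (hD : ∫ q, Metric.infDist (ofPort q) (satCone n n1 n2) ^ 2 ∂π ≤ D) :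
    Integrable (fun q => ‖ofPort q - satProj n n1 n2 (ofPort q)‖ ^ 2) π ∧
      ∫ q, ‖ofPort q - satProj n n1 n2 (ofPort q)‖ ^ 2 ∂π ≤ D := by
  have hle : ∀ q : PortMatrix n, ‖ofPort q - satProj n n1 n2 (ofPort q)‖ ^ 2
      ≤ Metric.infDist (ofPort q) (satCone n n1 n2) ^ 2 := fun q => by
    obtain ⟨x, hx, hd, -⟩ := exists_nearest_satCone (n1 := n1) (n2 := n2) (ofPort q)
    rw [hd]
    exact pow_le_pow_left₀ (norm_nonneg _) (norm_sub_satProj_le hx.1) 2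
  have hi : Integrable (fun q => ‖ofPort q - satProj n n1 n2 (ofPort q)‖ ^ 2) π :=
    hint.mono' (Measurable.of_discrete).aestronglyMeasurable (Eventually.of_forall fun q => by
      rw [Real.norm_of_nonneg (sq_nonneg _)]
      exact hle q)
  exact ⟨hi, (integral_mono hi hint hle).trans hD⟩

theorem abs_integral_inner_sub_satProj_le {π : Measure (PortMatrix n)} [IsProbabilityMeasure π]
    {D : ℝ} (hint : Integrable (fun q => ‖ofPort q - satProj n n1 n2 (ofPort q)‖ ^ 2) π)
    (hD : ∫ q, ‖ofPort q - satProj n n1 n2 (ofPort q)‖ ^ 2 ∂π ≤ D) (v : MatSpace n) :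
    Integrable (fun q => inner ℝ v (ofPort q - satProj n n1 n2 (ofPort q))) π ∧
      |∫ q, inner ℝ v (ofPort q - satProj n n1 n2 (ofPort q)) ∂π| ≤ ‖v‖ * (1 + D) := by
  have hle : ∀ q : PortMatrix n, |inner ℝ v (ofPort q - satProj n n1 n2 (ofPort q))|
      ≤ ‖v‖ * (1 + ‖ofPort q - satProj n n1 n2 (ofPort q)‖ ^ 2) := fun q =>
    (abs_real_inner_le_norm _ _).trans
      (mul_le_mul_of_nonneg_left (le_one_add_sq _) (norm_nonneg v))
  have hb : Integrable (fun q => ‖v‖ * (1 + ‖ofPort q - satProj n n1 n2 (ofPort q)‖ ^ 2)) π :=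
    ((integrable_const 1).add hint).const_mul _
  have hi : Integrable (fun q => inner ℝ v (ofPort q - satProj n n1 n2 (ofPort q))) π :=
    hb.mono' (Measurable.of_discrete).aestronglyMeasurable (Eventually.of_forall hle)
  refine ⟨hi, abs_integral_le_integral_abs.trans ((integral_mono hi.abs hb hle).trans ?_)⟩
  rw [integral_const_mul, integral_add (integrable_const _) hint]
  simp only [integral_const, probReal_univ, one_smul]
  exact mul_le_mul_of_nonneg_left (by linarith) (norm_nonneg v)

/-- The error in the heavy traffic approximation of the mean weighted queue length. -/
noncomputable def heavyTrafficError (n n1 n2 : ℕ) (k α : Fin n → Fin n → ℝ) (D ε : ℝ) : ℝ :=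
  n * (ε ^ 2 * ‖satProj n n1 n2 (toMat k)‖ ^ 2 + √ε * D
    + (√ε + ε) * inner ℝ (satSum n n1 n2) (toMat k)) + 2 * ε * (‖toMat α‖ * (1 + D))

theorem tendsto_heavyTrafficError (k α : Fin n → Fin n → ℝ) (D : ℝ) :
    Tendsto (heavyTrafficError n n1 n2 k α D) (𝓝[>] 0) (𝓝 0) := by
  have hc : Continuous (heavyTrafficError n n1 n2 k α D) := by
    unfold heavyTrafficError
    fun_prop
  have h0 : heavyTrafficError n n1 n2 k α D 0 = 0 := by simp [heavyTrafficError]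
  exact (h0 ▸ hc.tendsto 0).mono_left nhdsWithin_le_nhds

theorem meanWeighted_eq (π : Measure (PortMatrix n)) (α : Fin n → Fin n → ℝ) :
    meanWeighted π α = ∫ q, inner ℝ (toMat α) (ofPort q) ∂π := by
  refine integral_congr_ae (Eventually.of_forall fun q => ?_)
  simp only
  rw [real_inner_comm, ofPort, inner_toMat]

/-- Equal saturated sums give `P α = n P k`. The weighted mean is therefore `n` times the quantity
fixed by the quadratic balance, plus a pairing with `q - P q` whose mean is bounded. -/
theorem abs_meanWeighted_sub_le (hn1 : n1 < n) (hn2 : n2 < n) (hε : 0 < ε) (hφ : IsMaxWeight φ)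
    (hA : IsArrivalLaw A amax (fun i j => ν i j - ε * k i j))
    (hrow : ∀ i : Fin n, (i : ℕ) < n1 → ∑ j, ν i j = 1)
    (hcol : ∀ j : Fin n, (j : ℕ) < n2 → ∑ i, ν i j = 1)
    {π : Measure (PortMatrix n)} (hπ : IsSteadyState (switchKernel φ A) π)
    (hsq : Integrable (fun q => ‖ofPort q‖ ^ 2) π) {D : ℝ}
    (hint : Integrable (fun q => ‖ofPort q - satProj n n1 n2 (ofPort q)‖ ^ 2) π)
    (hD : ∫ q, ‖ofPort q - satProj n n1 n2 (ofPort q)‖ ^ 2 ∂π ≤ D) {α : Fin n → Fin n → ℝ}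
    (hαrow : ∀ i : Fin n, (i : ℕ) < n1 → ∑ j, α i j = n * ∑ j, k i j)
    (hαcol : ∀ j : Fin n, (j : ℕ) < n2 → ∑ i, α i j = n * ∑ i, k i j) :
    |2 * (ε * meanWeighted π α) - matInner (arrivalVariance A) (zeta n n1 n2)|
      ≤ heavyTrafficError n n1 n2 k α D ε := by
  have := hπ.prob
  have hn : (0 : ℝ) < n := by exact_mod_cast (Nat.zero_le _).trans_lt hn1
  have hPα : satProj n n1 n2 (toMat α) = (n : ℝ) • satProj n n1 n2 (toMat k) := by
    rw [← map_smul]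
    refine satProj_eq_of_sums (fun i hi => ?_) (fun j hj => ?_)
    · simpa [Finset.mul_sum] using hαrow i hi
    · simpa [Finset.mul_sum] using hαcol j hj
  obtain ⟨hi, hb⟩ := abs_integral_inner_sub_satProj_le hint hD (toMat α)
  have hik := integrable_inner hsq (satProj n n1 n2 (toMat k))
  have hmean : meanWeighted π α = n * ∫ q, inner ℝ (satProj n n1 n2 (toMat k)) (ofPort q) ∂π
      + ∫ q, inner ℝ (toMat α) (ofPort q - satProj n n1 n2 (ofPort q)) ∂π := by
    rw [meanWeighted_eq, ← integral_const_mul, ← integral_add (hik.const_mul _) hi]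
    refine integral_congr_ae (Eventually.of_forall fun q => ?_)
    simp only
    have : inner ℝ (toMat α) (satProj n n1 n2 (ofPort q))
        = n * inner ℝ (satProj n n1 n2 (toMat k)) (ofPort q) := by
      rw [← inner_satProj_left, hPα, inner_smul_left]
      simp
    rw [inner_sub_right, this]
    ring
  have hs : 0 < √ε := Real.sqrt_pos.mpr hε
  have hse : (√ε)⁻¹ * ε = √ε := by
    rw [inv_mul_eq_div, Real.div_sqrt]
  -- `θ = √ε` equalizes the orders of `θ D` and `θ⁻¹ ε`.
  have hmain := abs_integral_inner_satProj_sub_le hn1 hn2 hφ hA hrow hcol hπ hsq hs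
  set I := ∫ q, inner ℝ (satProj n n1 n2 (toMat k)) (ofPort q) ∂π
  set J := ∫ q, inner ℝ (toMat α) (ofPort q - satProj n n1 n2 (ofPort q)) ∂π
  set Z := matInner (arrivalVariance A) (zeta n n1 n2)
  set N := ‖satProj n n1 n2 (toMat k)‖ ^ 2
  set e := inner ℝ (satSum n n1 n2) (toMat k)
  have h1 : |2 * ε * I - (Z / n + ε ^ 2 * N)| ≤ √ε * D + (√ε + ε) * e := by
    refine hmain.trans ?_
    have h2 := mul_le_mul_of_nonneg_left hD hs.le
    have h3 : ((√ε)⁻¹ + 1) * (ε * e) = (√ε + ε) * e := by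
      rw [← mul_assoc, add_mul, hse, one_mul]
    rw [h3]
    linarith
  have e1 : 2 * (ε * meanWeighted π α) - Z
      = n * (2 * ε * I - (Z / n + ε ^ 2 * N)) + n * (ε ^ 2 * N) + 2 * ε * J := by
    rw [hmean]
    field_simp
    ring
  have h4 := abs_le.mp h1
  have h5 := abs_le.mp hb
  have h6 := mul_le_mul_of_nonneg_left h4.1 hn.le
  have h7 := mul_le_mul_of_nonneg_left h4.2 hn.le
  have h8 := mul_le_mul_of_nonneg_left h5.1 (by positivity : 0 ≤ 2 * ε)
  have h9 := mul_le_mul_of_nonneg_left h5.2 (by positivity : 0 ≤ 2 * ε)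
  have h10 : 0 ≤ n * (ε ^ 2 * N) := by positivity
  rw [e1, heavyTrafficError, abs_le]
  constructor <;> linarith

/-- The projection vanishes at pairs of unsaturated ports, so the queue there is an entry of `q - P
q`. -/
theorem abs_integral_apply_le {π : Measure (PortMatrix n)} [IsProbabilityMeasure π] {D : ℝ}
    (hint : Integrable (fun q => ‖ofPort q - satProj n n1 n2 (ofPort q)‖ ^ 2) π)
    (hD : ∫ q, ‖ofPort q - satProj n n1 n2 (ofPort q)‖ ^ 2 ∂π ≤ D) {i j : Fin n}
    (hi : n1 ≤ (i : ℕ)) (hj : n2 ≤ (j : ℕ)) : |∫ q, (q i j : ℝ) ∂π| ≤ 1 + D := by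
  have h := (abs_integral_inner_sub_satProj_le hint hD (EuclideanSpace.single (i, j) 1)).2
  have h2 : ∀ q : PortMatrix n, inner ℝ (EuclideanSpace.single (i, j) (1 : ℝ))
      (ofPort q - satProj n n1 n2 (ofPort q)) = q i j := fun q => by
    rw [EuclideanSpace.inner_single_left]
    simp [apply_eq_zero_of_mem_satSpace (satProj_mem (n1 := n1) (n2 := n2) (ofPort q))
      (p := (i, j)) hi hj]
  simp_rw [h2] at h
  simpa using h

theorem exists_uniform_slack {ι : Type*} [Finite ι] {f : ι → ℝ} (hf : ∀ i, f i < 1) :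
    ∃ η > 0, ∀ i, f i ≤ 1 - η := by
  rcases isEmpty_or_nonempty ι with h | h
  · exact ⟨1, one_pos, fun i => h.elim i⟩
  · obtain ⟨i, hi⟩ := Finite.exists_max f
    exact ⟨1 - f i, sub_pos.mpr (hf i), fun j => by linarith [hi j]⟩

end HeavyTraffic

/-! ### Assembly of the theorem -/

theorem mainTheorem1 (n n1 n2 : ℕ) (hn1 : n1 < n) (hn2 : n2 < n)
    (ν k : Fin n → Fin n → ℝ)
    (hν : ν ∈ intrinsicInterior ℝ (saturatedFace n n1 n2))
    (hνpos : ∀ i j, 0 < ν i j)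
    (hk : ∀ i j, 0 ≤ k i j)
    (hknorm : ∑ i, ∑ j, k i j = n)
    (hκrow : ∀ i : Fin n, (i : ℕ) < n1 → 0 < ∑ j, k i j)
    (hκcol : ∀ j : Fin n, (j : ℕ) < n2 → 0 < ∑ i, k i j)
    (ε₀ : ℝ) (hε₀ : ε₀ = nuMin' n1 n2 ν / (2 * matNorm k))
    (amax : ℕ) (sigmaSq : ℝ)
    (A : ℝ → Measure (PortMatrix n))
    (φ : ℝ → Kernel (PortMatrix n) (PortMatrix n))
    (hA : ∀ ε, 0 < ε → ε ≤ ε₀ → IsArrivalLaw (A ε) amax (fun i j => ν i j - ε * k i j))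
    (hσ : ∀ ε, 0 < ε → ε ≤ ε₀ → ∑ i, ∑ j, arrivalVariance (A ε) i j ≤ sigmaSq)
    (hφ : ∀ ε, 0 < ε → ε ≤ ε₀ → IsMaxWeight (φ ε)) :
    ∃ π : ℝ → Measure (PortMatrix n),
      (∀ ε, 0 < ε → ε ≤ ε₀ →
        IsSteadyState (switchKernel (φ ε) (A ε)) (π ε) ∧
        ∀ i j, Integrable (fun q : PortMatrix n => (q i j : ℝ)) (π ε)) ∧
      (∀ α : Fin n → Fin n → ℝ,
        (∀ i : Fin n, (i : ℕ) < n1 → ∑ j, α i j = n * ∑ j, k i j) →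
        (∀ j : Fin n, (j : ℕ) < n2 → ∑ i, α i j = n * ∑ i, k i j) →
        (∃ B₁ B₂ : ℝ → ℝ,
          Tendsto (fun ε => ε * B₁ ε) (𝓝[>] 0) (𝓝 0) ∧
          Tendsto (fun ε => ε * B₂ ε) (𝓝[>] 0) (𝓝 0) ∧
          ∀ ε, 0 < ε → ε ≤ ε₀ →
            1 / (2 * ε) * matInner (arrivalVariance (A ε)) (zeta n n1 n2) - B₁ ε
              ≤ meanWeighted (π ε) α ∧
            meanWeighted (π ε) α
              ≤ 1 / (2 * ε) * matInner (arrivalVariance (A ε)) (zeta n n1 n2) + B₂ ε) ∧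
        (∀ σ2 : Fin n → Fin n → ℝ,
          Tendsto (fun ε => arrivalVariance (A ε)) (𝓝[>] 0) (𝓝 σ2) →
          Tendsto (fun ε => ε * meanWeighted (π ε) α) (𝓝[>] 0)
            (𝓝 (1 / 2 * matInner σ2 (zeta n n1 n2))))) ∧
      (∀ i j : Fin n, n1 ≤ (i : ℕ) → n2 ≤ (j : ℕ) →
        Tendsto (fun ε => ε * ∫ q, (q i j : ℝ) ∂(π ε)) (𝓝[>] 0) (𝓝 0)) := by
  have hn : 0 < n := (Nat.zero_le _).trans_lt hn1
  obtain ⟨-, hrow, hcol⟩ := intrinsicInterior_subset hν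
  obtain ⟨hrow', hcol'⟩ := slack_of_mem_intrinsicInterior hn1 hn2 hν
  set m := nuMin' n1 n2 ν with hm_def
  have hm : 0 < m := nuMin'_pos hn1 hn2 hνpos hrow' hcol'
  obtain ⟨hm1, hm2, hm3⟩ := nuMin'_le (n1 := n1) (n2 := n2) ν
  have hk0 : 0 < ‖toMat k‖ := by
    refine norm_pos_iff.mpr fun h => ?_
    have h1 : ∀ i j, k i j = 0 := fun i j => by
      have := congrArg (fun x : MatSpace n => x (i, j)) h
      simpa using this
    simp only [h1, Finset.sum_const_zero] at hknorm
    have : (n : ℝ) ≠ 0 := Nat.cast_ne_zero.mpr hn.ne'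
    exact this hknorm.symm
  have hε₀pos : 0 < ε₀ := by
    rw [hε₀, ← norm_toMat]
    positivity
  -- Rates are strictly interior: saturated lines gain slack from positive `κ`, the others from the
  -- relative interior. This slack may shrink with `ε`, which is harmless for ergodicity.
  have hex : ∀ ε, 0 < ε → ε ≤ ε₀ → ∃ π, IsSteadyState (switchKernel (φ ε) (A ε)) π ∧
      Integrable (fun q => ‖ofPort q‖ ^ 2) π := by
    intro ε hε hle
    obtain ⟨η₁, h1, h1'⟩ := exists_uniform_slack
      (f := fun i : Fin n => ∑ j, (ν i j - ε * k i j)) fun i => by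
        rw [Finset.sum_sub_distrib, ← Finset.mul_sum]
        rcases lt_or_ge (i : ℕ) n1 with h | h
        · have := mul_pos hε (hκrow i h)
          linarith [hrow i h]
        · have := mul_nonneg hε.le (Finset.sum_nonneg fun j (_ : j ∈ Finset.univ) => hk i j)
          linarith [hrow' i h]
    obtain ⟨η₂, h2, h2'⟩ := exists_uniform_slack
      (f := fun j : Fin n => ∑ i, (ν i j - ε * k i j)) fun j => by
        rw [Finset.sum_sub_distrib, ← Finset.mul_sum]
        rcases lt_or_ge (j : ℕ) n2 with h | h
        · have := mul_pos hε (hκcol j h)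
          linarith [hcol j h]
        · have := mul_nonneg hε.le (Finset.sum_nonneg fun i (_ : i ∈ Finset.univ) => hk i j)
          linarith [hcol' j h]
    exact exists_isSteadyState (hφ ε hε hle) (hA ε hε hle) (lt_min h1 h2)
      (fun i => (h1' i).trans (by linarith [min_le_left η₁ η₂]))
      (fun j => (h2' j).trans (by linarith [min_le_right η₁ η₂]))
  choose! π hπ hsq using hex
  set D : ℝ := driftConst (m / (n + 1) / 2) (n * (amax + 1)) with hD_def
  -- The uniform collapse bound is obtained only for `ε ‖k‖ ≤ m / (2 (n + 1))`, a smaller range than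
  -- `(0, ε₀]`, which suffices for limits.
  have hsmall : ∀ᶠ ε in 𝓝[>] (0 : ℝ), 0 < ε ∧ ε ≤ ε₀ ∧
      Integrable (fun q => ‖ofPort q - satProj n n1 n2 (ofPort q)‖ ^ 2) (π ε) ∧
      ∫ q, ‖ofPort q - satProj n n1 n2 (ofPort q)‖ ^ 2 ∂(π ε) ≤ D := by
    have hε₁ : 0 < m / (n + 1) / 2 / ‖toMat k‖ := by positivity
    filter_upwards [Ioc_mem_nhdsGT hε₀pos, Ioc_mem_nhdsGT hε₁] with ε h1 h2
    obtain ⟨h3, h4⟩ := integral_infDist_satCone_sq_le (hφ ε h1.1 h1.2) (hA ε h1.1 h1.2) h1.1.le hm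
      ((le_div_iff₀ hk0).mp h2.2) hm1 hrow hcol hm2 hm3 (hπ ε h1.1 h1.2)
    exact ⟨h1.1, h1.2, integral_norm_sub_satProj_sq_le h3 h4⟩
  refine ⟨π, fun ε hε hle => ⟨hπ ε hε hle, fun i j => ?_⟩, fun α hαrow hαcol => ?_,
    fun i j hi hj => ?_⟩
  · have := (hπ ε hε hle).prob
    refine integrable_of_sq_bound (hsq ε hε hle) (c := 1) fun q => ?_
    rw [one_mul]
    exact (abs_apply_le_norm (ofPort q) (i, j)).trans (le_one_add_sq _)
  · have herr : ∀ᶠ ε in 𝓝[>] (0 : ℝ), 0 < ε ∧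
        |2 * (ε * meanWeighted (π ε) α) - matInner (arrivalVariance (A ε)) (zeta n n1 n2)|
          ≤ heavyTrafficError n n1 n2 k α D ε := by
      filter_upwards [hsmall] with ε ⟨h1, h2, h3, h4⟩
      exact ⟨h1, abs_meanWeighted_sub_le hn1 hn2 h1 (hφ ε h1 h2) (hA ε h1 h2) hrow hcol
        (hπ ε h1 h2) (hsq ε h1 h2) h3 h4 hαrow hαcol⟩
    have hlim : Tendsto (fun ε => 2 * (ε * meanWeighted (π ε) α)
        - matInner (arrivalVariance (A ε)) (zeta n n1 n2)) (𝓝[>] 0) (𝓝 0) :=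
      squeeze_zero_norm' (herr.mono fun ε h => h.2) (tendsto_heavyTrafficError k α D)
    refine ⟨?_, fun σ2 hσ2 => ?_⟩
    -- Taking the exact deviation as error makes both inequalities hold on all of `(0, ε₀]`; the
    -- content is that `ε B ε` tends to zero.
    · set B : ℝ → ℝ := fun ε => |meanWeighted (π ε) α
        - 1 / (2 * ε) * matInner (arrivalVariance (A ε)) (zeta n n1 n2)| with hB
      have hBlim : Tendsto (fun ε => ε * B ε) (𝓝[>] 0) (𝓝 0) := by
        have h1 := (hlim.abs).const_mul (1 / 2 : ℝ)
        rw [abs_zero, mul_zero] at h1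
        refine h1.congr' ?_
        filter_upwards [self_mem_nhdsWithin] with ε hε
        have hε' : (0 : ℝ) < ε := hε
        have e : 2 * (ε * meanWeighted (π ε) α)
            - matInner (arrivalVariance (A ε)) (zeta n n1 n2)
            = 2 * ε * (meanWeighted (π ε) α
              - 1 / (2 * ε) * matInner (arrivalVariance (A ε)) (zeta n n1 n2)) := by
          field_simp
        rw [e, abs_mul, abs_of_pos (by positivity : 0 < 2 * ε)]
        simp only [hB]
        ring
      refine ⟨B, B, hBlim, hBlim, fun ε _ _ => ?_⟩
      have h1 := neg_abs_le (meanWeighted (π ε) α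
        - 1 / (2 * ε) * matInner (arrivalVariance (A ε)) (zeta n n1 n2))
      have h2 := le_abs_self (meanWeighted (π ε) α
        - 1 / (2 * ε) * matInner (arrivalVariance (A ε)) (zeta n n1 n2))
      simp only [hB]
      constructor <;> linarith
    · have hcont : Continuous fun x : Fin n → Fin n → ℝ => matInner x (zeta n n1 n2) := by
        unfold matInner
        fun_prop
      have h1 := ((hlim.add ((hcont.tendsto σ2).comp hσ2)).const_mul (1 / 2 : ℝ))
      rw [zero_add] at h1
      refine h1.congr fun ε => ?_
      simp only [Function.comp_apply]
      ring
  · have h1 : Tendsto (fun ε : ℝ => ε * (1 + D)) (𝓝[>] 0) (𝓝 0) := by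
      have h2 : Continuous fun ε : ℝ => ε * (1 + D) := by fun_prop
      have h3 := h2.tendsto 0
      rw [zero_mul] at h3
      exact h3.mono_left nhdsWithin_le_nhds
    refine squeeze_zero_norm' ?_ h1
    filter_upwards [hsmall] with ε ⟨h2, h3, h4, h5⟩
    have := (hπ ε h2 h3).prob
    rw [norm_mul, Real.norm_of_nonneg h2.le]
    exact mul_le_mul_of_nonneg_left (abs_integral_apply_le h4 h5 hi hj) h2.le
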